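/- Let $k$ be an infinite field, $S=k[x_0,\dots,x_n]$, and let $I\subset S$ be an ideal of codimension at least $2$ generated by an $(r+1)$-dimensional vector space $W$ of forms of the same degree, with basis $f_0,\dots,f_r$. Let $\phi:\mathbf P^n\dashrightarrow\mathbf P^r=\mathbf P(W)$ be the associated rational map, which is a morphism on $\mathbf P^n\setminus V(I)$, and let $\ell(I)=1+\dim\overline{\phi(\mathbf P^n\setminus V(I))}$ be the analytic spread of $I$. A $k$-rational point $q$ of $\mathbf P(W)$ is a subspace $W_q\subset W$ of codimension $1$; write $I_q\subset S$ for the ideal generated by $W_q$. For a $k$-rational point $p\in\mathbf P^n\setminus V(I)$, the point $\phi(p)$ is given by $W_{\phi(p)}=\{h\in W: h(p)=0\}$. Put $I_q:I^\infty=\bigcup_m (I_q:I^m)$ (the morphism fiber ideal of $q$); the ideal $I_q:I$ is the row ideal of $q$. An ideal is called linear if it is generated by linear forms. "For a general point $p$" means: for all $k$-rational points $p$ of some non-empty Zariski open subset of $\mathbf P^n$ (contained in $\mathbf P^n\setminus V(I)$). (a) If $q$ is a $k$-rational point of $\mathbf P(W)$ with $I_q:I^\infty\neq S$, then $\ell(I)\ge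 1+\operatorname{codim}(I_q:I^\infty)$. (b) For a general point $p$ of $\mathbf P^n$, $\ell(I)=1+\operatorname{codim}(I_{\phi(p)}:I^\infty)$. (c) If there is a $k$-rational point $q$ of $\mathbf P(W)$ such that the row ideal $I_q:I$ is linear of codimension $n$ and does not contain $I$, then $\phi$ is birational onto its image. Moreover, $\phi$ is birational onto its image if and only if $I_{\phi(p)}:I^\infty$ is a linear ideal of codimension $n$ for a general point $p$ of $\mathbf P^n$. -/

import Mathlib

/-!
Let `W_q` be a hyperplane of `W` and `h ∈ W` a form outside it. Then `I_q : I^∞` is the contraction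
of `I_q S_h`, and `I_q S_h` is the extension of the maximal ideal of `q` in the coordinate ring
`A = k[f_0/h, …, f_r/h]` of the chart of `φ(P^n ∖ V(I))` cut out by `h ≠ 0`. So `I_q : I^∞`
describes the fibre of `Spec S_h → Spec A` over `q`. The height of a minimal prime of a fibre is at
most the height of the point below, which gives (a). By Noether normalization this morphism has the
going-down property over a non-empty open set, so equality holds for general fibres, which gives
(b).

If `φ` is birational onto its image, its inverse identifies the fibre through a general point `p`
with `p` itself, so that `I_{φ(p)} : I^∞` is the ideal of `p`. Conversely, on the chart `x_0 ≠ 0`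
a fibre that is a reduced rational point forces, by Nakayama's lemma, the local rings of `p` and
`φ(p)` to coincide after inverting one function, and the resulting expressions of the coordinates
as fractions in the `f_i / f_j` are the inverse map. If the row ideal of a single point `q` is
linear of codimension `n`, the relations `(p_b x_a - p_a x_b) h ∈ I_q` form a square linear system
for the `x_a` over `W`, nonsingular at `p`, which Cramer's rule solves by forms in the `f_i`.
-/

open MvPolynomial

noncomputable section

namespace RowIdeals

attribute [local instance] MvPolynomial.gradedAlgebra

variable {k : Type*} [Field k] {n r : ℕ}

/-- Projective `m`-space over `k` with its Zariski topology: the relevant homogeneous primes of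
`k[x_0, ..., x_m]`. -/
abbrev ProjSpace (k : Type*) [Field k] (m : ℕ) : Type _ :=
  ProjectiveSpectrum (homogeneousSubmodule (Fin (m + 1)) k)

/-- The vector space `W` spanned by the forms `f_0, ..., f_r`. -/
def formSpace (f : Fin (r + 1) → MvPolynomial (Fin (n + 1)) k) :
    Submodule k (MvPolynomial (Fin (n + 1)) k) :=
  Submodule.span k (Set.range f)

/-- The ideal `I` generated by `f_0, ..., f_r`. -/
def formIdeal (f : Fin (r + 1) → MvPolynomial (Fin (n + 1)) k) :
    Ideal (MvPolynomial (Fin (n + 1)) k) :=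
  Ideal.span (Set.range f)

/-! ### Rational points and the ideals attached to them -/

/-- A `k`-rational point `q` of `P(W)`: a subspace `W_q` of `W` of codimension one. -/
structure TargetPoint (W : Submodule k (MvPolynomial (Fin (n + 1)) k)) where
  /-- The subspace `W_q`. -/
  space : Submodule k (MvPolynomial (Fin (n + 1)) k)
  space_le : space ≤ W
  finrank_add_one : Module.finrank k space + 1 = Module.finrank k W

/-- The ideal `I_q` generated by `W_q`. -/
def TargetPoint.ideal {W : Submodule k (MvPolynomial (Fin (n + 1)) k)} (q : TargetPoint W) :
    Ideal (MvPolynomial (Fin (n + 1)) k) :=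
  Ideal.span (q.space : Set (MvPolynomial (Fin (n + 1)) k))

/-- The saturation `J : I^∞`, the union of the ideals `J : I^m`. -/
def saturation {R : Type*} [CommRing R] (J I : Ideal R) : Ideal R :=
  ⨆ m : ℕ, J.colon ((I ^ m : Ideal R) : Set R)

/-- The generalized row ideal `I_q : I`. -/
def rowIdeal (f : Fin (r + 1) → MvPolynomial (Fin (n + 1)) k) (q : TargetPoint (formSpace f)) :
    Ideal (MvPolynomial (Fin (n + 1)) k) :=
  q.ideal.colon (formIdeal f : Set (MvPolynomial (Fin (n + 1)) k))

/-- The morphism fiber ideal `I_q : I^∞`. -/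
def morphismFiberIdeal (f : Fin (r + 1) → MvPolynomial (Fin (n + 1)) k)
    (q : TargetPoint (formSpace f)) : Ideal (MvPolynomial (Fin (n + 1)) k) :=
  saturation q.ideal (formIdeal f)

/-- A linear ideal: an ideal generated by linear forms. -/
def IsLinearIdeal (J : Ideal (MvPolynomial (Fin (n + 1)) k)) : Prop :=
  ∃ s : Set (MvPolynomial (Fin (n + 1)) k), (∀ l ∈ s, l.IsHomogeneous 1) ∧ J = Ideal.span s

/-- The `k`-rational point `p` of `P^n` lies outside `V(I)`. -/
def IsRegularAt (f : Fin (r + 1) → MvPolynomial (Fin (n + 1)) k)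
    (p : Projectivization k (Fin (n + 1) → k)) : Prop :=
  ∃ i, eval p.rep (f i) ≠ 0

/-- The image `φ(p)` of a `k`-rational point `p` outside `V(I)`: the subspace of those elements
of `W` that vanish at `p`. -/
def imagePoint (f : Fin (r + 1) → MvPolynomial (Fin (n + 1)) k)
    (p : Projectivization k (Fin (n + 1) → k)) (hp : IsRegularAt f p) :
    TargetPoint (formSpace f) where
  space := formSpace f ⊓ LinearMap.ker (aeval p.rep : _ →ₐ[k] k).toLinearMap
  space_le := inf_le_left
  finrank_add_one := by
    obtain ⟨i, hi⟩ := hp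
    have : FiniteDimensional k (formSpace f) :=
      FiniteDimensional.span_of_finite k (Set.finite_range f)
    let e : Module.Dual k (formSpace f) :=
      (aeval p.rep : MvPolynomial (Fin (n + 1)) k →ₐ[k] k).toLinearMap ∘ₗ (formSpace f).subtype
    have he : e ≠ 0 := fun h => hi (by
      have := LinearMap.congr_fun h ⟨f i, Submodule.subset_span ⟨i, rfl⟩⟩
      simpa [e, aeval_eq_eval] using this)
    rw [← Module.Dual.finrank_ker_add_one_of_ne_zero he]
    congr 1
    rw [show LinearMap.ker e = (LinearMap.ker
      (aeval p.rep : MvPolynomial (Fin (n + 1)) k →ₐ[k] k).toLinearMap).comap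
        (formSpace f).subtype from LinearMap.ker_comp _ _]
    rw [← Submodule.map_comap_subtype, Submodule.finrank_map_subtype_eq]

/-- `P` holds for a general point of `P^n`: it holds for all `k`-rational points of some non-empty
Zariski open subset. (Every non-empty open subset contains the locus `g ≠ 0` of some
non-zero form `g`.) -/
def ForGeneralPoint (P : Projectivization k (Fin (n + 1) → k) → Prop) : Prop :=
  ∃ (g : MvPolynomial (Fin (n + 1)) k) (e : ℕ), g ≠ 0 ∧ g.IsHomogeneous e ∧
    ∀ p : Projectivization k (Fin (n + 1) → k), eval p.rep g ≠ 0 → P p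

/-! ### The rational map, its image and the analytic spread -/

/-- The morphism `φ : P^n ∖ V(I) → P^r` on all (scheme-theoretic) points: `φ(x)` is the prime
generated by the forms `G` with `G(f_0, ..., f_r) ∈ x`. -/
def ratMap (f : Fin (r + 1) → MvPolynomial (Fin (n + 1)) k) (x : ProjSpace k n)
    (hx : ∃ i, f i ∉ x.asHomogeneousIdeal.toIdeal) : ProjSpace k r where
  asHomogeneousIdeal :=
    (x.asHomogeneousIdeal.toIdeal.comap (bind₁ f)).homogeneousCore
      (homogeneousSubmodule (Fin (r + 1)) k)
  isPrime := (x.isPrime.comap (bind₁ f)).homogeneousCore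
  not_irrelevant_le := by
    obtain ⟨i, hi⟩ := hx
    intro h
    have hX : (X i : MvPolynomial (Fin (r + 1)) k) ∈
        HomogeneousIdeal.irrelevant (homogeneousSubmodule (Fin (r + 1)) k) :=
      HomogeneousIdeal.mem_irrelevant_of_mem _ one_pos (isHomogeneous_X k i)
    have := Ideal.toIdeal_homogeneousCore_le _ _ (h hX)
    simp at this
    exact hi this

/-- The set-theoretic image `φ(P^n ∖ V(I))` in `P^r`. -/
def ratImage (f : Fin (r + 1) → MvPolynomial (Fin (n + 1)) k) : Set (ProjSpace k r) :=
  {y | ∃ (x : ProjSpace k n) (hx : ∃ i, f i ∉ x.asHomogeneousIdeal.toIdeal), ratMap f x hx = y}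

/-- The analytic spread `ℓ(I)`: one plus the dimension of the (closed) image of `φ`. -/
def analyticSpread (f : Fin (r + 1) → MvPolynomial (Fin (n + 1)) k) : WithBot ℕ∞ :=
  1 + topologicalKrullDim (closure (ratImage f))

/-- The homogeneous ideal of the (closed) image of `φ`. -/
def imageIdeal (f : Fin (r + 1) → MvPolynomial (Fin (n + 1)) k) :
    Ideal (MvPolynomial (Fin (r + 1)) k) :=
  (ProjectiveSpectrum.vanishingIdeal (ratImage f)).toIdeal

/-- A tuple `g` represents a rational map from the projective variety with homogeneous prime ideal
`P`: its entries are forms of one degree, not all of them vanishing on the variety. -/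
def RepresentsRatMap {m s : ℕ} (P : Ideal (MvPolynomial (Fin (m + 1)) k))
    (g : Fin (s + 1) → MvPolynomial (Fin (m + 1)) k) : Prop :=
  (∃ e : ℕ, ∀ i, (g i).IsHomogeneous e) ∧ ∃ i, g i ∉ P

/-- Two tuples represent the same rational map from the projective variety with homogeneous prime
ideal `P`: both represent one, and they are proportional on the variety. -/
def SameRatMap {m s : ℕ} (P : Ideal (MvPolynomial (Fin (m + 1)) k))
    (g h : Fin (s + 1) → MvPolynomial (Fin (m + 1)) k) : Prop :=
  RepresentsRatMap P g ∧ RepresentsRatMap P h ∧ ∀ i j, g i * h j - g j * h i ∈ P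

/-- `φ` is birational onto its image: there is a rational map `ψ`, represented by `g`, from the
closed image of `φ` to `P^n` such that `ψ ∘ φ` is the identity of `P^n` and `φ ∘ ψ` is the identity
of the image, as rational maps. -/
def IsBirationalOntoImage (f : Fin (r + 1) → MvPolynomial (Fin (n + 1)) k) : Prop :=
  ∃ g : Fin (n + 1) → MvPolynomial (Fin (r + 1)) k,
    RepresentsRatMap (imageIdeal f) g ∧
    SameRatMap ⊥ (fun i => bind₁ f (g i)) X ∧
    SameRatMap (imageIdeal f) (fun i => bind₁ g (f i)) X

end RowIdeals

end

noncomputable section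

namespace RowIdeals

attribute [local instance] MvPolynomial.gradedAlgebra

section Heights

lemma height_eq_of_isMaximal {k : Type*} [Field k] (s : ℕ) (M : Ideal (MvPolynomial (Fin s) k))
    [M.IsMaximal] : M.height = s := by
  induction s with
  | zero =>
    have h : (M.height : WithBot ℕ∞) ≤ 0 := by
      simpa [MvPolynomial.ringKrullDim_of_isNoetherianRing] using
        Ideal.height_le_ringKrullDim_of_isPrime (I := M)
    exact nonpos_iff_eq_zero.mp (by exact_mod_cast h)
  | succ s ih =>
    let e := (finSuccEquiv k s).toRingEquiv
    have : (M.comap e.symm).IsMaximal := Ideal.comap_isMaximal_of_equiv e.symm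
    let p : Ideal (MvPolynomial (Fin s) k) := (M.comap e.symm).comap Polynomial.C
    have : p.IsMaximal := Polynomial.isMaximal_comap_C_of_isJacobsonRing _
    have : (M.comap e.symm).LiesOver p := ⟨rfl⟩
    rw [← e.symm.height_comap M, Polynomial.height_eq_height_add_one p, ih, Nat.cast_succ]

variable {A B : Type*} [CommRing A] [CommRing B] [Algebra A B]

lemma ringKrullDim_le_of_isIntegral [Algebra.IsIntegral A B] :
    ringKrullDim B ≤ ringKrullDim A :=
  Order.krullDim_le_of_strictMono (PrimeSpectrum.comap (algebraMap A B)) fun _ _ =>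
    Ideal.IsIntegral.comap_lt_comap

lemma height_under_le_of_hasGoingDown [Algebra.HasGoingDown A B] (Q : Ideal B) [Q.IsPrime] :
    (Q.under A).height ≤ Q.height := by
  rw [PrimeSpectrum.height_eq_orderHeight ⟨Q, ‹_›⟩,
    PrimeSpectrum.height_eq_orderHeight ⟨Q.under A, inferInstance⟩]
  refine Order.height_le fun l hl => ?_
  have : Q.LiesOver l.last.asIdeal := ⟨by rw [hl]⟩
  obtain ⟨L, hL, hlast, -⟩ := Ideal.exists_ltSeries_of_hasGoingDown l Q
  exact hL ▸ Order.length_le_height hlast.le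

lemma height_le_height_under_of_mem_minimalPrimes [IsNoetherianRing A] [IsNoetherianRing B]
    {J Q : Ideal B} (hQ : Q ∈ J.minimalPrimes)
    (hJ : J ≤ (Q.under A).map (algebraMap A B)) : Q.height ≤ (Q.under A).height := by
  have : Q.IsPrime := hQ.1.1
  have hmin : Q ∈ ((Q.under A).map (algebraMap A B)).minimalPrimes :=
    ⟨⟨‹_›, Ideal.map_comap_le⟩, fun p hp hpQ => hQ.2 ⟨hp.1, hJ.trans hp.2⟩ hpQ⟩
  rw [Ideal.minimalPrimes_eq_comap] at hmin
  obtain ⟨p, hp, hpQ⟩ := hmin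
  have hmap : Q.map (Ideal.Quotient.mk ((Q.under A).map (algebraMap A B))) = p :=
    (congrArg _ hpQ.symm).trans (Ideal.map_comap_of_surjective _ Ideal.Quotient.mk_surjective p)
  have : p.IsPrime := hp.1.1
  simpa only [hmap, Ideal.height_eq_zero_iff.mpr hp, add_zero] using
    Ideal.height_le_height_add_of_liesOver (Q.under A) Q

lemma isLocalizationAway_of_forall_exists_pow_mul_eq [FaithfulSMul A B] (b : A) (C : Type*)
    [CommRing C] [Algebra A C] [Algebra B C] [IsScalarTower A B C]
    [IsLocalization.Away (algebraMap A B b) C]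
    (h : ∀ x : B, ∃ (N : ℕ) (a : A), algebraMap A B b ^ N * x = algebraMap A B a) :
    IsLocalization.Away b C where
  map_units := by
    rintro ⟨_, N, rfl⟩
    simpa [IsScalarTower.algebraMap_apply A B C] using
      (IsLocalization.Away.algebraMap_isUnit (S := C) (algebraMap A B b)).pow N
  surj z := by
    obtain ⟨M, x, hx⟩ := IsLocalization.Away.surj (algebraMap A B b) z
    obtain ⟨N, a, ha⟩ := h x
    refine ⟨⟨a, ⟨_, N + M, rfl⟩⟩, ?_⟩
    simp only [IsScalarTower.algebraMap_apply A B C, ← ha, map_mul, map_pow, ← hx]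
    ring
  exists_of_eq {x y} hxy := by
    simp only [IsScalarTower.algebraMap_apply A B C] at hxy
    obtain ⟨N, hN⟩ := IsLocalization.Away.exists_of_eq (algebraMap A B b) hxy
    exact ⟨⟨_, N, rfl⟩, FaithfulSMul.algebraMap_injective A B (by simpa using hN)⟩

lemma height_under_of_forall_exists_pow_mul_eq [FaithfulSMul A B] (b : A)
    (h : ∀ x : B, ∃ (N : ℕ) (a : A), algebraMap A B b ^ N * x = algebraMap A B a)
    (Q : Ideal B) [Q.IsPrime] (hQ : algebraMap A B b ∉ Q) : (Q.under A).height = Q.height := by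
  let C := Localization.Away (algebraMap A B b)
  have : IsLocalization.Away b C := isLocalizationAway_of_forall_exists_pow_mul_eq b C h
  have hdis : Disjoint (Submonoid.powers (algebraMap A B b) : Set B) Q :=
    (Ideal.disjoint_powers_iff_notMem _ ‹Q.IsPrime›.isRadical).mpr hQ
  have hQC : (Q.map (algebraMap B C)).under B = Q :=
    IsLocalization.under_map_of_isPrime_disjoint _ C ‹_› hdis
  have hA : (Q.map (algebraMap B C)).under A = Q.under A := by
    rw [← Ideal.under_under (A := A) (B := B), hQC]
  rw [← hA, IsLocalization.height_under (Submonoid.powers b),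
    ← IsLocalization.height_under (Submonoid.powers (algebraMap A B b)), hQC]

end Heights

section NoetherNormalization

/-- The automorphism of a polynomial ring that multiplies each variable by a unit. It is used to
make the variables of a Noether normalization satisfy integrality conditions. -/
def rescale {K σ : Type*} [CommRing K] (c : σ → Kˣ) : MvPolynomial σ K ≃ₐ[K] MvPolynomial σ K :=
  AlgEquiv.ofAlgHom (aeval fun i => c i • X i) (aeval fun i => (c i)⁻¹ • X i)
    (by ext1 i; simp [Units.smul_def, smul_smul]) (by ext1 i; simp [Units.smul_def, smul_smul])

lemma exists_algebraicIndependent_isIntegral (K : Type*) {U : Type*} [Field K] [CommRing U]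
    [Nontrivial U] [Algebra K U] [Algebra.FiniteType K U] (S : Set U)
    (hS : ∀ x, ∃ c : Kˣ, c • x ∈ S) :
    ∃ (m : ℕ) (z : Fin m → U), (∀ i, z i ∈ S) ∧ AlgebraicIndependent K z ∧
      (aeval z : MvPolynomial (Fin m) K →ₐ[K] U).toRingHom.IsIntegral := by
  obtain ⟨m, g, ginj, gint⟩ := exists_integral_inj_algHom_of_fg K U
  choose c hc using fun i => hS (g (X i))
  have hz : aeval (fun i => c i • g (X i)) = g.comp (rescale c).toAlgHom := by
    ext1 i
    simp [rescale, Units.smul_def]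
  refine ⟨m, _, hc, ?_, ?_⟩
  · rw [algebraicIndependent_iff_injective_aeval, hz]
    exact ginj.comp (rescale c).injective
  · rw [hz]
    exact (RingHom.isIntegral_of_surjective _ (rescale c).surjective).trans _ _ gint

attribute [local instance] MvPolynomial.algebraMvPolynomial in
lemma exists_ne_zero_isIntegralElem_aeval {P K T U σ : Type*} [CommRing P] [IsDomain P] [CommRing K]
    [Algebra P K] [IsFractionRing P K] [CommRing T] [Algebra P T] [CommRing U] [Algebra P U]
    [Algebra K U] [Algebra T U] [FaithfulSMul T U] [IsScalarTower P K U] [IsScalarTower P T U]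
    (z : σ → T) {x : T}
    (hx : (aeval (algebraMap T U ∘ z) : MvPolynomial σ K →ₐ[K] U).toRingHom.IsIntegralElem
      (algebraMap T U x)) :
    ∃ b : P, b ≠ 0 ∧
      (aeval z : MvPolynomial σ P →ₐ[P] T).toRingHom.IsIntegralElem (algebraMap P T b * x) := by
  let : Algebra (MvPolynomial σ K) U := (aeval (algebraMap T U ∘ z)).toAlgebra
  let : Algebra (MvPolynomial σ P) T := (aeval z).toAlgebra
  let : Algebra (MvPolynomial σ P) U := (aeval (algebraMap T U ∘ z)).toAlgebra
  have : IsScalarTower (MvPolynomial σ P) (MvPolynomial σ K) U :=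
    IsScalarTower.of_algebraMap_eq fun q => (aeval_map_algebraMap _ _ q).symm
  have : IsScalarTower (MvPolynomial σ P) T U :=
    IsScalarTower.of_algebraMap_eq fun q => aeval_algebraMap_apply _ _ _
  obtain ⟨⟨_, b, hb, rfl⟩, hbx⟩ := IsIntegral.exists_multiple_integral_of_isLocalization
    ((nonZeroDivisors P).map (C (σ := σ))) _ hx
  refine ⟨b, nonZeroDivisors.ne_zero hb,
    (isIntegral_algebraMap_iff (FaithfulSMul.algebraMap_injective T U)).mp ?_⟩
  simpa [Submonoid.smul_def, Algebra.smul_def, RingHom.algebraMap_toAlgebra,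
    ← IsScalarTower.algebraMap_apply] using hbx

lemma exists_algebraicIndependent_isIntegralElem_of_isLocalization (P K T U : Type*) [CommRing P]
    [IsDomain P] [Field K] [Algebra P K] [IsFractionRing P K] [CommRing T] [IsDomain T]
    [Algebra P T] [FaithfulSMul P T] [CommRing U] [Algebra P U] [Algebra K U] [Algebra T U]
    [IsScalarTower P K U] [IsScalarTower P T U] [Algebra.FiniteType K U]
    [IsLocalization (Algebra.algebraMapSubmonoid T (nonZeroDivisors P)) U] :
    ∃ (m : ℕ) (z : Fin m → T), AlgebraicIndependent P z ∧ ∀ x, ∃ b : P, b ≠ 0 ∧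
      (aeval z : MvPolynomial (Fin m) P →ₐ[P] T).toRingHom.IsIntegralElem
        (algebraMap P T b * x) := by
  have hinj : Function.Injective (algebraMap T U) :=
    IsLocalization.injective (M := Algebra.algebraMapSubmonoid T (nonZeroDivisors P)) U
      (algebraMapSubmonoid_le_nonZeroDivisors_of_faithfulSMul T le_rfl)
  have : FaithfulSMul T U := (faithfulSMul_iff_algebraMap_injective _ _).mpr hinj
  have : Nontrivial U := hinj.nontrivial
  have hden (y : U) : ∃ c : Kˣ, c • y ∈ Set.range (algebraMap T U) := by
    obtain ⟨⟨x, ⟨_, p, hp, rfl⟩⟩, h⟩ :=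
      IsLocalization.surj (Algebra.algebraMapSubmonoid T (nonZeroDivisors P)) y
    refine ⟨(IsLocalization.map_units K (⟨p, hp⟩ : nonZeroDivisors P)).unit, x, ?_⟩
    rw [Units.smul_def, IsUnit.unit_spec, algebraMap_smul, Algebra.smul_def, ← h, mul_comm,
      IsScalarTower.algebraMap_apply P T U]
  obtain ⟨m, z, hzT, hz, hint⟩ := exists_algebraicIndependent_isIntegral K _ hden
  choose w hw using hzT
  obtain rfl : algebraMap T U ∘ w = z := funext hw
  exact ⟨m, w, (hz.restrictScalars (IsFractionRing.injective P K)).of_comp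
    (IsScalarTower.toAlgHom P T U), fun x => exists_ne_zero_isIntegralElem_aeval w (hint _)⟩

attribute [local instance] Algebra.TensorProduct.rightAlgebra in
lemma exists_algebraicIndependent_isIntegralElem (P T : Type*) [CommRing P] [IsDomain P]
    [CommRing T] [IsDomain T] [Algebra P T] [FaithfulSMul P T] [Algebra.FiniteType P T] :
    ∃ (m : ℕ) (z : Fin m → T), AlgebraicIndependent P z ∧ ∀ x, ∃ b : P, b ≠ 0 ∧
      (aeval z : MvPolynomial (Fin m) P →ₐ[P] T).toRingHom.IsIntegralElem
        (algebraMap P T b * x) :=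
  exists_algebraicIndependent_isIntegralElem_of_isLocalization P (FractionRing P) T
    (TensorProduct P (FractionRing P) T)

end NoetherNormalization

section GenericFibre

lemma exists_pow_smul_mem_of_adjoin_eq_top {P T : Type*} [CommRing P] [CommRing T] [Algebra P T]
    {t : Set T} (ht : Algebra.adjoin P t = ⊤) (C : Subalgebra P T) {b : P}
    (hC : ∀ x ∈ t, b • x ∈ C) (x : T) : ∃ N : ℕ, b ^ N • x ∈ C := by
  have hx : x ∈ Algebra.adjoin P t := ht ▸ Algebra.mem_top
  induction hx using Algebra.adjoin_induction with
  | mem x hx => exact ⟨1, by simpa using hC x hx⟩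
  | algebraMap a => exact ⟨0, by simp⟩
  | add x y _ _ hx hy =>
    obtain ⟨⟨N, hN⟩, ⟨M, hM⟩⟩ := And.intro hx hy
    refine ⟨N + M, smul_add (b ^ (N + M)) x y ▸ C.add_mem ?_ ?_⟩
    · simpa only [add_comm N, pow_add, mul_smul] using C.smul_mem hN (b ^ M)
    · simpa only [pow_add, mul_smul] using C.smul_mem hM (b ^ N)
  | mul x y _ _ hx hy =>
    obtain ⟨⟨N, hN⟩, ⟨M, hM⟩⟩ := And.intro hx hy
    exact ⟨N + M, by simpa only [smul_mul_smul_comm, pow_add] using C.mul_mem hN hM⟩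

lemma exists_ne_zero_forall_exists_pow_smul_mem {P T : Type*} [CommRing P] [IsDomain P]
    [CommRing T] [Algebra P T] [Algebra.FiniteType P T] (C : Subalgebra P T)
    (hC : ∀ x, ∃ b : P, b ≠ 0 ∧ b • x ∈ C) :
    ∃ b : P, b ≠ 0 ∧ ∀ x, ∃ N : ℕ, b ^ N • x ∈ C := by
  classical
  obtain ⟨t, ht⟩ := ‹Algebra.FiniteType P T›.out
  choose b hb hbC using hC
  refine ⟨∏ x ∈ t, b x, Finset.prod_ne_zero_iff.mpr fun x _ => hb x,
    exists_pow_smul_mem_of_adjoin_eq_top ht C fun x hx => ?_⟩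
  rw [← Finset.prod_erase_mul _ _ hx, mul_smul]
  exact C.smul_mem (hbC x) _

lemma exists_ne_zero_forall_height_under_le (P T : Type*) [CommRing P] [IsDomain P]
    [UniqueFactorizationMonoid P] [CommRing T] [IsDomain T] [Algebra P T] [FaithfulSMul P T]
    [Algebra.FiniteType P T] :
    ∃ b : P, b ≠ 0 ∧ ∀ Q : Ideal T, Q.IsPrime → algebraMap P T b ∉ Q →
      (Q.under P).height ≤ Q.height := by
  obtain ⟨m, z, hz, hint⟩ := exists_algebraicIndependent_isIntegralElem P T
  let R := MvPolynomial (Fin m) P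
  let : Algebra R T := (aeval z).toAlgebra
  have : IsScalarTower P R T := IsScalarTower.of_algebraMap_eq fun a => (aeval_C z a).symm
  have : FaithfulSMul R T := (faithfulSMul_iff_algebraMap_injective R T).mpr hz
  let C := integralClosure R T
  have : FaithfulSMul R C := (faithfulSMul_iff_algebraMap_injective R C).mpr
    fun a c h => hz (congrArg Subtype.val h)
  have : Algebra.HasGoingDown P C := Algebra.HasGoingDown.trans P R C
  obtain ⟨b, hb, hbC⟩ := exists_ne_zero_forall_exists_pow_smul_mem (C.restrictScalars P)
    fun x => (hint x).imp fun b h => ⟨h.1, by rw [Algebra.smul_def]; exact h.2⟩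
  refine ⟨b, hb, fun Q hQ hbQ => ?_⟩
  have hheight : (Q.under C).height = Q.height :=
    height_under_of_forall_exists_pow_mul_eq (algebraMap P C b) (fun x => by
      obtain ⟨N, hN⟩ := hbC x
      exact ⟨N, ⟨_, hN⟩, by
        rw [← map_pow, ← map_pow, ← IsScalarTower.algebraMap_apply, ← Algebra.smul_def]
        rfl⟩) Q hbQ
  rw [← hheight, ← Ideal.under_under (A := P) (B := C)]
  exact height_under_le_of_hasGoingDown _

lemma exists_ne_zero_forall_ringKrullDim_le_height (k B T : Type*) [Field k] [CommRing B]
    [IsDomain B] [CommRing T] [IsDomain T] [Algebra k B] [Algebra k T] [Algebra B T]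
    [IsScalarTower k B T] [FaithfulSMul B T] [Algebra.FiniteType k B] [Algebra.FiniteType k T] :
    ∃ b : B, b ≠ 0 ∧ ∀ Q : Ideal T, Q.IsPrime → (Q.under B).IsMaximal → algebraMap B T b ∉ Q →
      ringKrullDim B ≤ Q.height := by
  obtain ⟨s, g, ginj, gint⟩ := exists_integral_inj_algHom_of_fg k B
  let P := MvPolynomial (Fin s) k
  let : Algebra P B := g.toAlgebra
  let : Algebra P T := ((algebraMap B T).comp g.toRingHom).toAlgebra
  have : IsScalarTower P B T := IsScalarTower.of_algebraMap_eq fun _ => rfl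
  have : IsScalarTower k P B := IsScalarTower.of_algebraMap_eq fun a => (g.commutes a).symm
  have : IsScalarTower k P T := IsScalarTower.to₁₂₄ k P B T
  have : FaithfulSMul P B := (faithfulSMul_iff_algebraMap_injective P B).mpr ginj
  have : FaithfulSMul P T := FaithfulSMul.trans P B T
  have : Algebra.IsIntegral P B := ⟨gint⟩
  have : Algebra.FiniteType P T := .of_restrictScalars_finiteType k P T
  obtain ⟨b, hb, h⟩ := exists_ne_zero_forall_height_under_le P T
  refine ⟨algebraMap P B b, by simpa using hb, fun Q hQ hmax hbQ => ?_⟩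
  have : (Q.under P).IsMaximal := by
    rw [← Ideal.under_under (A := P) (B := B)]
    exact Ideal.isMaximal_comap_of_isIntegral_of_isMaximal _
  have hs : (s : ℕ∞) ≤ Q.height := by
    rw [← height_eq_of_isMaximal s (Q.under P)]
    exact h Q hQ (by rwa [IsScalarTower.algebraMap_apply P B T])
  calc ringKrullDim B ≤ ringKrullDim P := ringKrullDim_le_of_isIntegral
    _ = (s : ℕ∞) := by simp [P, ringKrullDim_of_isNoetherianRing]
    _ ≤ Q.height := WithBot.coe_le_coe.mpr hs

end GenericFibre

section ReducedRationalFibre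
variable {A T : Type*} [CommRing A] [CommRing T] [Algebra A T] (M : Ideal T)

lemma quasiFiniteAt_of_le_map_under [Algebra.FiniteType A T] [M.IsPrime] [Module.Finite A (T ⧸ M)]
    (hM : M ≤ (M.under A).map (algebraMap A T)) : Algebra.QuasiFiniteAt A M := by
  have hMeq : (M.under A).map (algebraMap A T) = M := le_antisymm Ideal.map_comap_le hM
  have hquot (J : Ideal T) (hJ : J = M) [(M.map (Ideal.Quotient.mk J)).IsPrime] :
      Algebra.QuasiFiniteAt A (M.map (Ideal.Quotient.mk J)) := by
    subst hJ
    infer_instance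
  have : Algebra.WeaklyQuasiFiniteAt A M := hquot _ hMeq
  exact .of_weaklyQuasiFiniteAt M

lemma isAlgebraic_of_quasiFiniteAt [IsDomain A] [IsDomain T] [FaithfulSMul A T]
    [M.IsPrime] [Algebra.QuasiFiniteAt A M] : Algebra.IsAlgebraic A T := by
  have : Algebra.QuasiFiniteAt A (⊥ : Ideal T) := .of_le (bot_le (a := M))
  have : IsLocalization.AtPrime (FractionRing T) (⊥ : Ideal T) := by
    rw [IsLocalization.AtPrime, Ideal.primeCompl_bot]
    infer_instance
  have : Algebra.QuasiFinite A (FractionRing T) := .of_surjective_algHom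
    ((IsLocalization.algEquiv (⊥ : Ideal T).primeCompl (Localization.AtPrime (⊥ : Ideal T))
      (FractionRing T)).toAlgHom.restrictScalars A) (AlgEquiv.surjective _)
  let : Algebra (FractionRing A) (FractionRing T) := FractionRing.liftAlgebra A _
  have := FractionRing.isScalarTower_liftAlgebra A (FractionRing T)
  have : Algebra.QuasiFinite (FractionRing A) (FractionRing T) := .of_restrictScalars A _ _
  have : Module.Finite (FractionRing A) (FractionRing T) := Module.Finite.of_quasiFinite
  have : Algebra.IsAlgebraic A (FractionRing T) :=
    (IsFractionRing.comap_isAlgebraic_iff (K := FractionRing A)).mpr inferInstance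
  exact .of_injective (IsScalarTower.toAlgHom A T (FractionRing T)) (IsFractionRing.injective _ _)

lemma pow_smul_mem_smul_of_mem_map {q : Ideal A} {C : Subalgebra A T} {b : A}
    (hb : ∀ x : T, ∃ N : ℕ, b ^ N • x ∈ C) {x : T} (hx : x ∈ q.map (algebraMap A T)) :
    ∃ N : ℕ, b ^ N • x ∈ q • C.toSubmodule := by
  have hx : x ∈ q • (⊤ : Submodule A T) := by
    rwa [Ideal.smul_top_eq_map]
  refine Submodule.smul_induction_on hx (fun a ha y _ => ?_) fun x y hx hy => ?_
  · obtain ⟨N, hN⟩ := hb y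
    exact ⟨N, smul_comm (b ^ N) a y ▸ Submodule.smul_mem_smul ha hN⟩
  · obtain ⟨⟨N, hN⟩, ⟨M, hM⟩⟩ := And.intro hx hy
    refine ⟨N + M, smul_add (b ^ (N + M)) x y ▸ add_mem ?_ ?_⟩
    · simpa only [add_comm N, pow_add, mul_smul] using Submodule.smul_mem _ (b ^ M) hN
    · simpa only [pow_add, mul_smul] using Submodule.smul_mem _ (b ^ N) hM

lemma mem_smul_of_pow_smul_mem_smul {q : Ideal A} [q.IsMaximal] {E : Type*} [AddCommGroup E]
    [Module A E] {N : Submodule A E} {b : A} (hb : b ∉ q) {y : E} (hy : y ∈ N) {e : ℕ}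
    (h : b ^ e • y ∈ q • N) : y ∈ q • N := by
  obtain ⟨c, i, hi, hci⟩ :=
    Ideal.IsMaximal.exists_inv ‹_› (mt (Ideal.IsPrime.mem_of_pow_mem inferInstance e) hb)
  rw [← one_smul A y, ← hci, add_smul, mul_smul]
  exact add_mem (Submodule.smul_mem _ c h) (Submodule.smul_mem_smul hi hy)

lemma exists_notMem_forall_smul_eq_algebraMap {C : Subalgebra A T} (hC : C.toSubmodule.FG)
    [hmax : (M.under A).IsMaximal] {b : A} (hb : ∀ x : T, ∃ N : ℕ, b ^ N • x ∈ C)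
    (hbM : b ∉ M.under A) (hres : ∀ x : T, ∃ a : A, x - algebraMap A T a ∈ M)
    (hM : M ≤ (M.under A).map (algebraMap A T)) :
    ∀ x : T, ∃ s ∉ M.under A, ∃ a, s • x = algebraMap A T a := by
  have hle : C.toSubmodule ≤ 1 ⊔ (M.under A) • C.toSubmodule := fun y hy => by
    obtain ⟨a, ha⟩ := hres y
    have hya : y - algebraMap A T a ∈ C := C.sub_mem hy (C.algebraMap_mem a)
    obtain ⟨N, hN⟩ := pow_smul_mem_smul_of_mem_map hb (hM ha)
    rw [← sub_add_cancel y (algebraMap A T a), add_comm]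
    exact Submodule.add_mem_sup (Submodule.algebraMap_mem a)
      (mem_smul_of_pow_smul_mem_smul hbM hya hN)
  obtain ⟨r, hr, hrC⟩ := Submodule.exists_sub_one_mem_and_smul_le_of_fg_of_le_sup hC le_rfl hle
  have hrM : r ∉ M.under A := fun h => hmax.ne_top
    ((Ideal.eq_top_iff_one _).mpr (by simpa using sub_mem h hr))
  intro x
  obtain ⟨N, hN⟩ := hb x
  refine ⟨r * b ^ N, hmax.isPrime.mul_notMem hrM (mt (hmax.isPrime.mem_of_pow_mem N) hbM), ?_⟩
  obtain ⟨a, ha⟩ := Submodule.mem_one.mp (hrC (Submodule.smul_mem_pointwise_smul _ r _ hN))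
  exact ⟨a, by rw [ha, mul_smul]⟩

lemma exists_fg_subalgebra_forall_exists_pow_smul_mem (A T : Type*) [CommRing A] [IsDomain A]
    [CommRing T] [Algebra A T] [Algebra.FiniteType A T] [Algebra.IsAlgebraic A T] :
    ∃ (C : Subalgebra A T) (b : A), C.toSubmodule.FG ∧ b ≠ 0 ∧ ∀ x, ∃ N : ℕ, b ^ N • x ∈ C := by
  classical
  obtain ⟨t, ht⟩ := ‹Algebra.FiniteType A T›.out
  obtain ⟨b, hb, hint⟩ := Algebra.IsAlgebraic.exists_integral_multiples A t
  refine ⟨Algebra.adjoin A ((b • ·) '' (t : Set T)), b,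
    fg_adjoin_of_finite (t.finite_toSet.image _) (Set.forall_mem_image.mpr hint), hb,
    exists_pow_smul_mem_of_adjoin_eq_top ht _ fun x hx =>
      Algebra.subset_adjoin (Set.mem_image_of_mem _ hx)⟩

end ReducedRationalFibre

section PointIdeals

lemma aeval_mul_left_of_isHomogeneous {R A σ : Type*} [CommSemiring R] [CommSemiring A]
    [Algebra R A] {G : MvPolynomial σ R} {e : ℕ} (hG : G.IsHomogeneous e) (c : A) (v : σ → A) :
    aeval (fun i => c * v i) G = c ^ e * aeval v G := by
  simp only [aeval_def, eval₂_eq, Finset.mul_sum]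
  refine Finset.sum_congr rfl fun m hm => ?_
  rw [hG.degree_eq_sum_deg_support hm]
  simp only [mul_pow, Finset.prod_mul_distrib, Finset.prod_pow_eq_pow_sum]
  ring

variable {k σ : Type*} [Field k] {n : ℕ}

/-- The homogeneous ideal of the point of projective space with homogeneous coordinates `p`. -/
def pointIdeal (p : σ → k) : Ideal (MvPolynomial σ k) :=
  Ideal.span (Set.range fun ij : σ × σ => C (p ij.1) * X ij.2 - C (p ij.2) * X ij.1)

lemma C_mul_X_sub_mem_pointIdeal (p : σ → k) (i j : σ) :
    C (p i) * X j - C (p j) * X i ∈ pointIdeal p :=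
  Ideal.subset_span ⟨(i, j), rfl⟩

lemma pointIdeal_le_iff {p : σ → k} {J : Ideal (MvPolynomial σ k)} :
    pointIdeal p ≤ J ↔ ∀ i j, C (p i) * X j - C (p j) * X i ∈ J := by
  simp only [pointIdeal, Ideal.span_le, Set.range_subset_iff, Prod.forall, SetLike.mem_coe]

lemma isLinearIdeal_pointIdeal (p : Fin (n + 1) → k) : IsLinearIdeal (pointIdeal p) :=
  ⟨_, Set.forall_mem_range.mpr fun _ =>
    (isHomogeneous_C_mul_X _ _).sub (isHomogeneous_C_mul_X _ _), rfl⟩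

lemma eval_eq_zero_of_mem_pointIdeal {p : σ → k} {G : MvPolynomial σ k}
    (hG : G ∈ pointIdeal p) : eval p G = 0 := by
  have : pointIdeal p ≤ RingHom.ker (eval p) :=
    pointIdeal_le_iff.mpr fun i j => by simp [RingHom.mem_ker, mul_comm]
  exact this hG

lemma mem_pointIdeal_of_isHomogeneous {p : σ → k} (hp : p ≠ 0) {G : MvPolynomial σ k} {e : ℕ}
    (hG : G.IsHomogeneous e) (h0 : eval p G = 0) : G ∈ pointIdeal p := by
  obtain ⟨a, ha⟩ := Function.ne_iff.mp hp
  let π := Ideal.Quotient.mkₐ k (pointIdeal p)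
  have hX (j : σ) : π (C (p a)) * π (X j) = π (X a) * π (C (p j)) := by
    rw [← map_mul, ← map_mul, mul_comm (X a)]
    exact Ideal.Quotient.eq.mpr (C_mul_X_sub_mem_pointIdeal p a j)
  have hp_eval : aeval (fun j => π (C (p j))) G = 0 := by
    have hC : (fun j => π (C (p j))) = algebraMap k _ ∘ p := funext fun j => π.commutes (p j)
    rw [hC, aeval_algebraMap_apply, aeval_eq_eval, h0, map_zero]
  have hmul : C (p a ^ e) * G ∈ pointIdeal p := by
    refine Ideal.Quotient.eq_zero_iff_mem.mp ?_
    change π _ = 0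
    calc π (C (p a ^ e) * G) = π (C (p a)) ^ e * aeval (fun j => π (X j)) G := by
          rw [map_mul, map_pow, map_pow, ← comp_aeval_apply, aeval_X_left_apply]
      _ = 0 := by
          rw [← aeval_mul_left_of_isHomogeneous hG]
          simp_rw [hX]
          rw [aeval_mul_left_of_isHomogeneous hG, hp_eval, mul_zero]
  have := Ideal.mul_mem_left _ (C (p a ^ e)⁻¹) hmul
  rwa [← mul_assoc, ← C_mul, inv_mul_cancel₀ (pow_ne_zero e ha), C_1, one_mul] at this

lemma coeff_aeval_X_mul_C (p : σ → k) (G : MvPolynomial σ k) (e : ℕ) :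
    (aeval (fun a => Polynomial.X * Polynomial.C (p a)) G).coeff e =
      eval p (homogeneousComponent e G) := by
  have hcomp (i : ℕ) : (aeval (fun a => Polynomial.X * Polynomial.C (p a))
      (homogeneousComponent i G)) =
        Polynomial.C (eval p (homogeneousComponent i G)) * Polynomial.X ^ i := by
    rw [aeval_mul_left_of_isHomogeneous (homogeneousComponent_isHomogeneous i G), mul_comm]
    exact congrArg (· * _) (aeval_algebraMap_apply (Polynomial k) p _)
  conv_lhs => rw [← sum_homogeneousComponent G]
  simp only [map_sum, hcomp, Polynomial.finsetSum_coeff, Polynomial.coeff_C_mul_X_pow,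
    Finset.sum_ite_eq, Finset.mem_range, Nat.lt_succ_iff]
  exact ite_eq_left_iff.mpr fun h => by
    rw [homogeneousComponent_eq_zero _ _ (not_le.mp h), map_zero]

lemma pointIdeal_eq_ker {p : σ → k} (hp : p ≠ 0) :
    pointIdeal p = RingHom.ker (aeval fun a => Polynomial.X * Polynomial.C (p a) :
      MvPolynomial σ k →ₐ[k] Polynomial k) := by
  refine le_antisymm (pointIdeal_le_iff.mpr fun i j => ?_) fun G hG => ?_
  · simp only [RingHom.mem_ker, map_sub, map_mul, aeval_X, algHom_C, Polynomial.algebraMap_eq]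
    ring
  · rw [← sum_homogeneousComponent G]
    refine Ideal.sum_mem _ fun e _ =>
      mem_pointIdeal_of_isHomogeneous hp (homogeneousComponent_isHomogeneous e G) ?_
    rw [← coeff_aeval_X_mul_C, RingHom.mem_ker.mp hG, Polynomial.coeff_zero]

lemma isPrime_pointIdeal {p : σ → k} (hp : p ≠ 0) : (pointIdeal p).IsPrime := by
  rw [pointIdeal_eq_ker hp]
  exact RingHom.ker_isPrime _

lemma pointIdeal_smul {c : k} (hc : c ≠ 0) (p : σ → k) : pointIdeal (c • p) = pointIdeal p := by
  have hle (c : k) (p : σ → k) : pointIdeal (c • p) ≤ pointIdeal p :=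
    pointIdeal_le_iff.mpr fun i j => by
      have := Ideal.mul_mem_left _ (C c) (C_mul_X_sub_mem_pointIdeal p i j)
      rwa [mul_sub, ← mul_assoc, ← mul_assoc, ← C_mul, ← C_mul] at this
  refine le_antisymm (hle c p) ?_
  conv_lhs => rw [← inv_smul_smul₀ hc p]
  exact hle c⁻¹ (c • p)

lemma comap_rename_pointIdeal {p : σ → k} (hp : p ≠ 0) (s : Equiv.Perm σ) :
    (pointIdeal p).comap (renameEquiv k s).toRingEquiv = pointIdeal (p ∘ s) := by
  have hps : p ∘ s ≠ 0 := fun h => hp (funext fun i => by simpa using congrFun h (s.symm i))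
  ext G
  simp only [pointIdeal_eq_ker hp, pointIdeal_eq_ker hps, Ideal.mem_comap, RingHom.mem_ker]
  exact iff_of_eq (congrArg (· = 0) (aeval_rename s _ G))

/-- The automorphism of the polynomial ring which fixes `x_0` and adds `c_a x_0` to the variable
`x_{a+1}`; it moves every point with `x_0 = 1` to the point `(1, 0, ..., 0)` for suitable `c`. -/
def shear (c : Fin n → k) : MvPolynomial (Fin (n + 1)) k ≃ₐ[k] MvPolynomial (Fin (n + 1)) k :=
  AlgEquiv.ofAlgHom (aeval (Fin.cons (X 0) fun a => X a.succ + C (c a) * X 0))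
    (aeval (Fin.cons (X 0) fun a => X a.succ - C (c a) * X 0))
    (by ext1 i; cases i using Fin.cases <;> simp) (by ext1 i; cases i using Fin.cases <;> simp)

lemma shear_X_zero (c : Fin n → k) : shear c (X 0) = X 0 :=
  aeval_X _ _

lemma shear_X_succ (c : Fin n → k) (a : Fin n) :
    shear c (X a.succ) = X a.succ + C (c a) * X 0 :=
  aeval_X _ _

lemma height_pointIdeal_of_apply_zero_eq_one {p : Fin (n + 1) → k} (hp : p 0 = 1) :
    (pointIdeal p).height = n := by
  have hp0 : p ≠ 0 := fun h => by simp [h] at hp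
  let E : MvPolynomial (Fin (n + 1)) k ≃ₐ[k] Polynomial (MvPolynomial (Fin n) k) :=
    (shear fun a => p a.succ).trans (finSuccEquiv k n)
  let ε : MvPolynomial (Fin n) k →ₐ[k] k := aeval 0
  have : (RingHom.ker ε).IsMaximal :=
    RingHom.ker_isMaximal_of_surjective _ fun c => ⟨C c, by simp [ε]⟩
  have hcomp : (aeval fun a => Polynomial.X * Polynomial.C (p a)) =
      (Polynomial.mapAlgHom ε).comp E.toAlgHom := by
    ext1 i
    cases i using Fin.cases with
    | zero => simp [E, shear_X_zero, hp, finSuccEquiv_X_zero]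
    | succ a =>
      have hE : E (X a.succ) = Polynomial.C (X a) + algebraMap k _ (p a.succ) * Polynomial.X := by
        rw [AlgEquiv.trans_apply, shear_X_succ, map_add, map_mul, finSuccEquiv_X_succ,
          finSuccEquiv_X_zero, ← algebraMap_eq, AlgEquiv.commutes]
      rw [AlgHom.comp_apply, AlgEquiv.toAlgHom_apply, hE, map_add, map_mul, AlgHom.commutes]
      simp only [aeval_X, Polynomial.coe_mapAlgHom, Polynomial.map_C, Polynomial.map_X,
        Polynomial.algebraMap_eq, RingHom.coe_coe, ε, Pi.zero_apply, map_zero, zero_add, mul_comm]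
  have hcomap : pointIdeal p = ((RingHom.ker ε).map Polynomial.C).comap E.toRingEquiv := by
    rw [pointIdeal_eq_ker hp0, hcomp]
    exact congrArg (Ideal.comap E.toRingEquiv) (Polynomial.ker_mapRingHom ε.toRingHom)
  rw [hcomap, RingEquiv.height_comap, Polynomial.height_map_C, height_eq_of_isMaximal]

lemma height_pointIdeal {p : Fin (n + 1) → k} (hp : p ≠ 0) : (pointIdeal p).height = n := by
  obtain ⟨a, ha⟩ := Function.ne_iff.mp hp
  let s := Equiv.swap 0 a
  rw [← (renameEquiv k s).toRingEquiv.height_comap, comap_rename_pointIdeal hp,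
    ← pointIdeal_smul (inv_ne_zero ha)]
  exact height_pointIdeal_of_apply_zero_eq_one (by simp [s, inv_mul_cancel₀ ha])

end PointIdeals

section LinearIdeals
variable {k : Type*} [Field k] {n : ℕ}

/-- The linear form `v_0 x_0 + ... + v_n x_n`, as a linear function of `v`. -/
def linearForm : (Fin (n + 1) → k) →ₗ[k] MvPolynomial (Fin (n + 1)) k :=
  Fintype.linearCombination k X

lemma exists_linearForm_eq {l : MvPolynomial (Fin (n + 1)) k} (hl : l.IsHomogeneous 1) :
    ∃ v, linearForm v = l := by
  rw [← mem_homogeneousSubmodule, homogeneousSubmodule_one_eq_span_X,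
    ← Fintype.range_linearCombination] at hl
  exact hl

lemma IsLinearIdeal.exists_eq_span_image_linearForm {J : Ideal (MvPolynomial (Fin (n + 1)) k)}
    (hJ : IsLinearIdeal J) :
    ∃ U : Submodule k (Fin (n + 1) → k), J = Ideal.span (linearForm '' U) := by
  obtain ⟨s, hs, rfl⟩ := hJ
  refine ⟨(Submodule.span k s).comap linearForm,
    le_antisymm (Ideal.span_mono fun l hl => ?_) (Ideal.span_le.mpr ?_)⟩
  · obtain ⟨v, rfl⟩ := exists_linearForm_eq (hs l hl)
    exact ⟨v, Submodule.subset_span hl, rfl⟩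
  · rintro _ ⟨v, hv, rfl⟩
    exact Submodule.span_le_restrictScalars k (MvPolynomial (Fin (n + 1)) k) s hv

lemma height_span_image_linearForm_le (U : Submodule k (Fin (n + 1) → k))
    (hU : Ideal.span (linearForm '' (U : Set (Fin (n + 1) → k))) ≠ ⊤) :
    (Ideal.span (linearForm '' (U : Set (Fin (n + 1) → k)))).height ≤ Module.finrank k U := by
  let b := Module.finBasis k U
  let t : Set (MvPolynomial (Fin (n + 1)) k) := (fun i => linearForm (b i)) '' Set.univ
  have ht : Ideal.span (linearForm '' (U : Set (Fin (n + 1) → k))) = Ideal.span t := by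
    refine le_antisymm (Ideal.span_le.mpr ?_) (Ideal.span_mono ?_)
    · rintro _ ⟨v, hv, rfl⟩
      have hv_sum : ∑ i, b.repr ⟨v, hv⟩ i • (b i : Fin (n + 1) → k) = v := by
        simpa only [Submodule.coe_sum, Submodule.coe_smul] using
          congrArg Subtype.val (b.sum_repr ⟨v, hv⟩)
      rw [SetLike.mem_coe, ← hv_sum, map_sum]
      refine Ideal.sum_mem _ fun i _ => ?_
      rw [map_smul, smul_eq_C_mul]
      exact Ideal.mul_mem_left _ _ (Ideal.subset_span ⟨i, trivial, rfl⟩)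
    · rintro _ ⟨i, -, rfl⟩
      exact ⟨b i, (b i).2, rfl⟩
  rw [ht] at hU ⊢
  calc (Ideal.span t).height ≤ (Ideal.span t).spanFinrank := Ideal.height_le_spanFinrank _ hU
    _ ≤ t.encard := Submodule.spanFinrank_span_le_encard t
    _ ≤ (Set.univ : Set (Fin (Module.finrank k U))).encard := Set.encard_image_le _ _
    _ = Module.finrank k U := by simp

lemma exists_forall_dotProduct_eq_zero_imp_mem {U : Submodule k (Fin (n + 1) → k)}
    (hU : n ≤ Module.finrank k U) : ∃ p : Fin (n + 1) → k, p ≠ 0 ∧ ∀ v, p ⬝ᵥ v = 0 → v ∈ U := by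
  rcases eq_or_ne U ⊤ with rfl | hU_top
  · exact ⟨1, one_ne_zero, fun _ _ => trivial⟩
  obtain ⟨φ, hφ, hUφ⟩ := Submodule.exists_le_ker_of_lt_top U (lt_top_iff_ne_top.mpr hU_top)
  have hU_eq : U = LinearMap.ker φ := by
    refine Submodule.eq_of_le_of_finrank_le hUφ ?_
    have := Module.Dual.finrank_ker_add_one_of_ne_zero hφ
    rw [Module.finrank_fin_fun] at this
    omega
  refine ⟨(dotProductEquiv k (Fin (n + 1))).symm φ, by simpa using hφ, fun v hv => ?_⟩
  rwa [hU_eq, LinearMap.mem_ker, ← (dotProductEquiv k (Fin (n + 1))).apply_symm_apply φ,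
    dotProductEquiv_apply_apply]

lemma exists_eq_pointIdeal {J : Ideal (MvPolynomial (Fin (n + 1)) k)} (hJ : IsLinearIdeal J)
    (hh : J.height = n) : ∃ p : Fin (n + 1) → k, p ≠ 0 ∧ J = pointIdeal p := by
  obtain ⟨U, rfl⟩ := hJ.exists_eq_span_image_linearForm
  have hne : Ideal.span (linearForm '' (U : Set (Fin (n + 1) → k))) ≠ ⊤ := fun h => by
    rw [h, Ideal.height_top] at hh
    exact ENat.top_ne_natCast n hh
  obtain ⟨p, hp, hpU⟩ := exists_forall_dotProduct_eq_zero_imp_mem (U := U) <| by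
    exact_mod_cast hh ▸ height_span_image_linearForm_le U hne
  have hle : pointIdeal p ≤ Ideal.span (linearForm '' (U : Set (Fin (n + 1) → k))) :=
    pointIdeal_le_iff.mpr fun i j => Ideal.subset_span
      ⟨p i • Pi.single j 1 - p j • Pi.single i 1, hpU _ (by simp [mul_comm]), by
        simp [linearForm, smul_eq_C_mul]⟩
  have := isPrime_pointIdeal hp
  exact ⟨p, hp, (Ideal.eq_of_le_of_height_le _ hle (by rw [hh, height_pointIdeal hp])).symm⟩

end LinearIdeals

section Homogenization
variable {k σ : Type*} [Field k]

/-- The form of degree `G.totalDegree` obtained from `G` by multiplying its homogeneous components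
by powers of the linear form `l`. -/
def homogenize (l G : MvPolynomial σ k) : MvPolynomial σ k :=
  ∑ e ∈ Finset.range (G.totalDegree + 1), l ^ (G.totalDegree - e) * homogeneousComponent e G

lemma isHomogeneous_homogenize {l : MvPolynomial σ k} (hl : l.IsHomogeneous 1)
    (G : MvPolynomial σ k) : (homogenize l G).IsHomogeneous G.totalDegree := by
  refine IsHomogeneous.sum _ _ _ fun e he => ?_
  have h := (hl.pow (G.totalDegree - e)).mul (homogeneousComponent_isHomogeneous e G)
  rwa [one_mul, Nat.sub_add_cancel (Nat.lt_succ_iff.mp (Finset.mem_range.mp he))] at h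

lemma map_homogenize {A : Type*} [CommSemiring A] [Algebra k A] (φ : MvPolynomial σ k →ₐ[k] A)
    {l : MvPolynomial σ k} (hl : φ l = 1) (G : MvPolynomial σ k) :
    φ (homogenize l G) = φ G := by
  conv_rhs => rw [← sum_homogeneousComponent G]
  simp [homogenize, hl]

end Homogenization

section ImageDimension
variable {k σ : Type*} [Field k] {n r : ℕ}

lemma exists_X_notMem (x : ProjSpace k r) : ∃ i, X i ∉ x.asHomogeneousIdeal.toIdeal := by
  by_contra! h
  have hspan : Ideal.span (X '' Set.univ) ≤ x.asHomogeneousIdeal.toIdeal :=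
    Ideal.span_le.mpr (Set.image_subset_iff.mpr fun i _ => h i)
  refine x.not_irrelevant_le ((HomogeneousIdeal.irrelevant_le _).mpr fun e he G hG => hspan ?_)
  refine mem_ideal_span_X_image.mpr fun m hm => ?_
  have hdeg : m.degree = e :=
    (((mem_homogeneousSubmodule e G).mp hG).degree_eq_sum_deg_support hm).symm
  by_contra! hcon
  have hm0 : m = 0 := Finsupp.ext fun i => by simpa using hcon i
  rw [hm0, map_zero] at hdeg
  exact he.ne hdeg

/-- The generic point of projective space. -/
def projGenericPoint (k : Type*) [Field k] (n : ℕ) : ProjSpace k n where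
  asHomogeneousIdeal := ⊥
  isPrime := Ideal.isPrime_bot
  not_irrelevant_le h := X_ne_zero (R := k) (0 : Fin (n + 1))
    (h (HomogeneousIdeal.mem_irrelevant_of_mem _ one_pos (isHomogeneous_X k 0)))

lemma mem_imageIdeal_iff {f : Fin (r + 1) → MvPolynomial (Fin (n + 1)) k} (hne : ∃ i, f i ≠ 0)
    {G : MvPolynomial (Fin (r + 1)) k} {e : ℕ} (hG : G.IsHomogeneous e) :
    G ∈ imageIdeal f ↔ bind₁ f G = 0 := by
  refine ⟨fun h => ?_, fun h => (ProjectiveSpectrum.mem_vanishingIdeal _ _).mpr ?_⟩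
  · exact Ideal.toIdeal_homogeneousCore_le _ _
      ((ProjectiveSpectrum.mem_vanishingIdeal _ _).mp h _ ⟨projGenericPoint k n, hne, rfl⟩)
  · rintro _ ⟨x, hx, rfl⟩
    refine Ideal.mem_homogeneousCore_of_homogeneous_of_mem ⟨e, hG⟩ ?_
    rw [Ideal.mem_comap, h]
    exact Ideal.zero_mem _

/-- The points of the closed image of the rational map, ordered by inclusion of homogeneous
primes. -/
abbrev ImagePoints (f : Fin (r + 1) → MvPolynomial (Fin (n + 1)) k) : Type _ :=
  {x : ProjSpace k r // imageIdeal f ≤ x.asHomogeneousIdeal.toIdeal}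

lemma mem_closure_ratImage_iff (f : Fin (r + 1) → MvPolynomial (Fin (n + 1)) k)
    (x : ProjSpace k r) :
    x ∈ closure (ratImage f) ↔ imageIdeal f ≤ x.asHomogeneousIdeal.toIdeal := by
  rw [← ProjectiveSpectrum.zeroLocus_vanishingIdeal_eq_closure]
  exact ProjectiveSpectrum.mem_zeroLocus _ _ _

lemma topologicalKrullDim_eq_krullDim {Y P : Type*} [TopologicalSpace Y] [QuasiSober Y]
    [T0Space Y] [Preorder P] (e : Y ≃ P) (he : ∀ x y, e x ≤ e y ↔ x ⤳ y) :
    topologicalKrullDim Y = Order.krullDim P := by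
  let := specializationOrder Y
  let e' : Y ≃o Pᵒᵈ := ⟨e.trans OrderDual.toDual, fun {x y} => he y x⟩
  rw [← Order.krullDim_orderDual]
  exact Order.krullDim_eq_of_orderIso (irreducibleSetEquivPoints.trans e')

lemma topologicalKrullDim_closure_ratImage (f : Fin (r + 1) → MvPolynomial (Fin (n + 1)) k) :
    topologicalKrullDim (closure (ratImage f)) = Order.krullDim (ImagePoints f) := by
  have : QuasiSober (ProjSpace k r) := inferInstanceAs
    (QuasiSober (AlgebraicGeometry.Proj (homogeneousSubmodule (Fin (r + 1)) k)))
  have : T0Space (ProjSpace k r) := inferInstanceAs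
    (T0Space (AlgebraicGeometry.Proj (homogeneousSubmodule (Fin (r + 1)) k)))
  have : QuasiSober (closure (ratImage f)) :=
    isClosed_closure.isClosedEmbedding_subtypeVal.quasiSober
  refine topologicalKrullDim_eq_krullDim (Equiv.subtypeEquivRight (mem_closure_ratImage_iff f))
    fun x y => ?_
  rw [← Topology.IsInducing.subtypeVal.specializes_iff, specializes_iff_mem_closure]
  exact ProjectiveSpectrum.le_iff_mem_closure (𝒜 := homogeneousSubmodule (Fin (r + 1)) k) _ _

lemma le_of_forall_isHomogeneous {J K : Ideal (MvPolynomial (Fin (r + 1)) k)}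
    (hJ : J.IsHomogeneous (homogeneousSubmodule (Fin (r + 1)) k))
    (h : ∀ (e : ℕ) (G : MvPolynomial (Fin (r + 1)) k), G.IsHomogeneous e → G ∈ J → G ∈ K) :
    J ≤ K := by
  intro G hG
  rw [← sum_homogeneousComponent G]
  exact Ideal.sum_mem _ fun e _ => h e _ (homogeneousComponent_isHomogeneous e G)
    (homogeneousComponent_mem_of_mem hJ hG e)

lemma isHomogeneous_imageIdeal (f : Fin (r + 1) → MvPolynomial (Fin (n + 1)) k) :
    (imageIdeal f).IsHomogeneous (homogeneousSubmodule (Fin (r + 1)) k) :=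
  (ProjectiveSpectrum.vanishingIdeal (ratImage f)).isHomogeneous

/-- The substitution `y_j ↦ f_j / h`. -/
def ratioHom (f : Fin (r + 1) → MvPolynomial σ k) (h : MvPolynomial σ k) :
    MvPolynomial (Fin (r + 1)) k →ₐ[k] Localization.Away h :=
  aeval fun j => IsLocalization.Away.invSelf h * algebraMap _ _ (f j)

lemma ratioHom_of_isHomogeneous (f : Fin (r + 1) → MvPolynomial σ k)
    (h : MvPolynomial σ k) {G : MvPolynomial (Fin (r + 1)) k} {e : ℕ}
    (hG : G.IsHomogeneous e) :
    ratioHom f h G = IsLocalization.Away.invSelf h ^ e * algebraMap _ _ (bind₁ f G) := by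
  rw [ratioHom, aeval_mul_left_of_isHomogeneous hG]
  congr 1
  exact aeval_algebraMap_apply (Localization.Away h) f G

lemma ratioHom_bind₁_eq_one (f : Fin (r + 1) → MvPolynomial σ k)
    {l : MvPolynomial (Fin (r + 1)) k} (hl : l.IsHomogeneous 1) :
    ratioHom f (bind₁ f l) l = 1 := by
  rw [ratioHom_of_isHomogeneous f _ hl, pow_one, mul_comm]
  exact IsLocalization.Away.mul_invSelf _

lemma ratioHom_X_self (f : Fin (r + 1) → MvPolynomial σ k) (i : Fin (r + 1)) :
    ratioHom f (f i) (X i) = 1 := by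
  have h := ratioHom_bind₁_eq_one f (isHomogeneous_X k i)
  rwa [bind₁_X_right] at h

lemma isUnit_invSelf {R : Type*} [CommRing R] (h : R) :
    IsUnit (IsLocalization.Away.invSelf h : Localization.Away h) :=
  .of_mul_eq_one_right _ (IsLocalization.Away.mul_invSelf h)

lemma ratioHom_eq_zero_iff (f : Fin (r + 1) → MvPolynomial σ k)
    {h : MvPolynomial σ k} (hh : h ≠ 0) {G : MvPolynomial (Fin (r + 1)) k} {e : ℕ}
    (hG : G.IsHomogeneous e) : ratioHom f h G = 0 ↔ bind₁ f G = 0 := by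
  rw [ratioHom_of_isHomogeneous f h hG, ((isUnit_invSelf h).pow e).mul_right_eq_zero,
    map_eq_zero_iff]
  exact IsLocalization.injective _ (powers_le_nonZeroDivisors_of_noZeroDivisors hh)

/-- For `ρ : k[y_0, …, y_r] → B` with `ρ l = 1` for a linear form `l`, the morphism from `Spec B`
to the chart `l ≠ 0` of projective space. -/
def specToProj {B : Type*} [CommRing B] [Algebra k B] (ρ : MvPolynomial (Fin (r + 1)) k →ₐ[k] B)
    {l : MvPolynomial (Fin (r + 1)) k} (hl : l.IsHomogeneous 1) (hρ : ρ l = 1)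
    (q : PrimeSpectrum B) : ProjSpace k r where
  asHomogeneousIdeal := (q.asIdeal.comap ρ).homogeneousCore (homogeneousSubmodule (Fin (r + 1)) k)
  isPrime := (q.isPrime.comap ρ).homogeneousCore
  not_irrelevant_le h := by
    have hlq : ρ l ∈ q.asIdeal := Ideal.toIdeal_homogeneousCore_le _ (q.asIdeal.comap ρ)
      (h (HomogeneousIdeal.mem_irrelevant_of_mem _ one_pos hl))
    exact q.isPrime.one_notMem (hρ ▸ hlq)

lemma mem_specToProj_iff {B : Type*} [CommRing B] [Algebra k B]
    {ρ : MvPolynomial (Fin (r + 1)) k →ₐ[k] B} {l : MvPolynomial (Fin (r + 1)) k}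
    (hl : l.IsHomogeneous 1) (hρ : ρ l = 1) (q : PrimeSpectrum B)
    {G : MvPolynomial (Fin (r + 1)) k} {e : ℕ} (hG : G.IsHomogeneous e) :
    G ∈ (specToProj ρ hl hρ q).asHomogeneousIdeal.toIdeal ↔ ρ G ∈ q.asIdeal :=
  ⟨fun h => Ideal.toIdeal_homogeneousCore_le _ (q.asIdeal.comap ρ) h,
    fun h => Ideal.mem_homogeneousCore_of_homogeneous_of_mem (I := q.asIdeal.comap ρ) ⟨e, hG⟩ h⟩

lemma specToProj_strictMono {B : Type*} [CommRing B] [Algebra k B]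
    {ρ : MvPolynomial (Fin (r + 1)) k →ₐ[k] B} (hsurj : Function.Surjective ρ)
    {l : MvPolynomial (Fin (r + 1)) k} (hl : l.IsHomogeneous 1) (hρ : ρ l = 1) :
    StrictMono (specToProj ρ hl hρ) := by
  refine fun q₁ q₂ hq => lt_of_le_not_ge
    (Ideal.homogeneousCore_mono _ (Ideal.comap_mono (f := ρ) hq.le))
    fun hle => hq.not_ge fun b hb => ?_
  obtain ⟨G, rfl⟩ := hsurj b
  rw [← map_homogenize ρ hρ, ← mem_specToProj_iff hl hρ _ (isHomogeneous_homogenize hl G)] at hb ⊢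
  exact hle hb

lemma ringKrullDim_range_ratioHom_le {f : Fin (r + 1) → MvPolynomial (Fin (n + 1)) k}
    (hne : ∃ i, f i ≠ 0) {l : MvPolynomial (Fin (r + 1)) k} (hl : l.IsHomogeneous 1) :
    ringKrullDim (ratioHom f (bind₁ f l)).range ≤ topologicalKrullDim (closure (ratImage f)) := by
  rw [topologicalKrullDim_closure_ratImage]
  let ρ := (ratioHom f (bind₁ f l)).rangeRestrict
  have hρ : ρ l = 1 := Subtype.ext (ratioHom_bind₁_eq_one f hl)
  have himage (q) : imageIdeal f ≤ (specToProj ρ hl hρ q).asHomogeneousIdeal.toIdeal := by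
    refine le_of_forall_isHomogeneous (isHomogeneous_imageIdeal f) fun e G hG hGf => ?_
    have hzero : ρ G = 0 := Subtype.ext <| (ratioHom_of_isHomogeneous f _ hG).trans <| by
      rw [(mem_imageIdeal_iff hne hG).mp hGf, map_zero, mul_zero, ZeroMemClass.coe_zero]
    rw [mem_specToProj_iff hl hρ q hG, hzero]
    exact Ideal.zero_mem _
  exact Order.krullDim_le_of_strictMono
    (fun q => (⟨specToProj ρ hl hρ q, himage q⟩ : ImagePoints f))
    fun _ _ hq => specToProj_strictMono (AlgHom.rangeRestrict_surjective _) hl hρ hq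

/-- The substitution `y_j ↦ y_j / y_i` on the variety with homogeneous prime `x`. -/
def chartHom (x : ProjSpace k r) (i : Fin (r + 1)) : MvPolynomial (Fin (r + 1)) k →ₐ[k]
    FractionRing (MvPolynomial (Fin (r + 1)) k ⧸ x.asHomogeneousIdeal.toIdeal) :=
  aeval fun j => (algebraMap _ _ (X i : MvPolynomial (Fin (r + 1)) k))⁻¹ *
    algebraMap _ _ (X j : MvPolynomial (Fin (r + 1)) k)

lemma algebraMap_fractionRing_quotient_eq_zero_iff {A : Type*} [CommRing A] (J : Ideal A)
    {G : A} : algebraMap A (FractionRing (A ⧸ J)) G = 0 ↔ G ∈ J := by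
  rw [IsScalarTower.algebraMap_apply A (A ⧸ J), map_eq_zero_iff _ (IsFractionRing.injective _ _),
    Ideal.Quotient.algebraMap_eq, Ideal.Quotient.eq_zero_iff_mem]

section chartHom
variable {x y : ProjSpace k r} {i : Fin (r + 1)}

lemma chartHom_eq_zero_iff_of_isHomogeneous (hi : X i ∉ x.asHomogeneousIdeal.toIdeal)
    {G : MvPolynomial (Fin (r + 1)) k} {e : ℕ} (hG : G.IsHomogeneous e) :
    chartHom x i G = 0 ↔ G ∈ x.asHomogeneousIdeal.toIdeal := by
  have hXi := (algebraMap_fractionRing_quotient_eq_zero_iff x.asHomogeneousIdeal.toIdeal).not.mpr hi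
  have hbase := aeval_algebraMap_apply (R := k) (A := MvPolynomial (Fin (r + 1)) k)
    (FractionRing (MvPolynomial (Fin (r + 1)) k ⧸ x.asHomogeneousIdeal.toIdeal)) X G
  rw [Function.comp_def, aeval_X_left, AlgHom.id_apply] at hbase
  rw [chartHom, aeval_mul_left_of_isHomogeneous hG, hbase,
    mul_eq_zero_iff_left (pow_ne_zero _ (inv_ne_zero hXi)),
    algebraMap_fractionRing_quotient_eq_zero_iff]

lemma chartHom_eq_zero_iff (hi : X i ∉ x.asHomogeneousIdeal.toIdeal)
    (G : MvPolynomial (Fin (r + 1)) k) :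
    chartHom x i G = 0 ↔ homogenize (X i) G ∈ x.asHomogeneousIdeal.toIdeal := by
  have hXi := (algebraMap_fractionRing_quotient_eq_zero_iff x.asHomogeneousIdeal.toIdeal).not.mpr hi
  rw [← chartHom_eq_zero_iff_of_isHomogeneous hi (isHomogeneous_homogenize (isHomogeneous_X k i) G),
    map_homogenize]
  rw [chartHom, aeval_X]
  exact inv_mul_cancel₀ hXi

lemma ker_chartHom_le_ker_chartHom_iff (hx : X i ∉ x.asHomogeneousIdeal.toIdeal)
    (hy : X i ∉ y.asHomogeneousIdeal.toIdeal) :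
    RingHom.ker (chartHom x i) ≤ RingHom.ker (chartHom y i) ↔ x ≤ y := by
  refine ⟨fun h => le_of_forall_isHomogeneous x.asHomogeneousIdeal.isHomogeneous
    fun e G hG hGx => ?_, fun h G hG => ?_⟩
  · exact (chartHom_eq_zero_iff_of_isHomogeneous hy hG).mp
      (h ((chartHom_eq_zero_iff_of_isHomogeneous hx hG).mpr hGx))
  · exact (chartHom_eq_zero_iff hy G).mpr (h ((chartHom_eq_zero_iff hx G).mp hG))

lemma ker_ratioHom_le_ker_chartHom {f : Fin (r + 1) → MvPolynomial (Fin (n + 1)) k}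
    (hfi : f i ≠ 0) (hx : X i ∉ x.asHomogeneousIdeal.toIdeal)
    (hxf : imageIdeal f ≤ x.asHomogeneousIdeal.toIdeal) :
    RingHom.ker (ratioHom f (f i)) ≤ RingHom.ker (chartHom x i) := by
  intro G hG
  have hhom := isHomogeneous_homogenize (isHomogeneous_X k i) G
  rw [RingHom.mem_ker, ← map_homogenize _ (ratioHom_X_self f i), ratioHom_eq_zero_iff f hfi hhom,
    ← mem_imageIdeal_iff ⟨i, hfi⟩ hhom] at hG
  exact (chartHom_eq_zero_iff hx G).mpr (hxf hG)

end chartHom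

lemma krullDim_chart_le {f : Fin (r + 1) → MvPolynomial (Fin (n + 1)) k} {i : Fin (r + 1)}
    (hfi : f i ≠ 0) :
    Order.krullDim {x : ImagePoints f // X i ∉ x.1.asHomogeneousIdeal.toIdeal} ≤
      ringKrullDim (ratioHom f (f i)).range := by
  let ρ := (ratioHom f (f i)).rangeRestrict
  have hρ : Function.Surjective ρ := AlgHom.rangeRestrict_surjective _
  have hker (x : {x : ImagePoints f // X i ∉ x.1.asHomogeneousIdeal.toIdeal}) :
      ∃ q : PrimeSpectrum (ratioHom f (f i)).range,
        q.asIdeal.comap ρ = RingHom.ker (chartHom x.1.1 i) := by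
    have hle : RingHom.ker ρ ≤ RingHom.ker (chartHom x.1.1 i) := fun G hG =>
      ker_ratioHom_le_ker_chartHom hfi x.2 x.1.2 (congrArg Subtype.val hG)
    have hprime : (RingHom.ker (chartHom x.1.1 i)).IsPrime := RingHom.ker_isPrime _
    exact ⟨⟨_, Ideal.map_isPrime_of_surjective hρ hle⟩,
      (Ideal.comap_map_of_surjective _ hρ _).trans (sup_eq_left.mpr hle)⟩
  choose F hF using hker
  have hmono (x y) : F x ≤ F y ↔ x ≤ y := by
    rw [← PrimeSpectrum.asIdeal_le_asIdeal, ← Ideal.comap_le_comap_iff_of_surjective _ hρ, hF, hF]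
    exact ker_chartHom_le_ker_chartHom_iff x.2 y.2
  exact Order.krullDim_le_of_strictMono F fun x y hxy =>
    lt_of_le_not_ge ((hmono x y).mpr hxy.le) ((hmono y x).not.mpr hxy.not_ge)

lemma topologicalKrullDim_closure_ratImage_le {f : Fin (r + 1) → MvPolynomial (Fin (n + 1)) k}
    (hne : ∃ i, f i ≠ 0) {N : WithBot ℕ∞}
    (hN : ∀ i, f i ≠ 0 → ringKrullDim (ratioHom f (f i)).range ≤ N) :
    topologicalKrullDim (closure (ratImage f)) ≤ N := by
  rw [topologicalKrullDim_closure_ratImage]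
  refine iSup_le fun s => ?_
  obtain ⟨i, hi⟩ := exists_X_notMem s.last.1
  have hfi : f i ≠ 0 := fun h => hi <| s.last.2 <|
    (mem_imageIdeal_iff hne (isHomogeneous_X k i)).mpr (by rw [bind₁_X_right, h])
  let chain : LTSeries {x : ImagePoints f // X i ∉ x.1.asHomogeneousIdeal.toIdeal} :=
    { length := s.length
      toFun := fun j => ⟨s j, fun h => hi (LTSeries.monotone s (Fin.le_last j) h)⟩
      step := fun j => s.step j }
  exact (Order.LTSeries.length_le_krullDim chain).trans ((krullDim_chart_le hfi).trans (hN i hfi))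

end ImageDimension

section Saturation
variable {R : Type*} [CommRing R] {I J : Ideal R} {h : R}

lemma mem_saturation_iff (hI : h ∈ I) (hle : I ≤ J ⊔ Ideal.span {h}) {s : R} :
    s ∈ saturation J I ↔ ∃ m : ℕ, h ^ m * s ∈ J := by
  have hmono : Monotone fun m : ℕ => J.colon ((I ^ m : Ideal R) : Set R) := fun _ _ hab _ hs =>
    Submodule.mem_colon.mpr fun t ht => Submodule.mem_colon.mp hs t (Ideal.pow_le_pow_right hab ht)
  rw [saturation, Submodule.mem_iSup_of_directed _ hmono.directed_le]
  refine ⟨fun ⟨m, hs⟩ => ⟨m, ?_⟩, fun ⟨m, hs⟩ => ⟨1 + m, Submodule.mem_colon.mpr fun t ht => ?_⟩⟩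
  · rw [mul_comm]
    exact Submodule.mem_colon.mp hs (h ^ m) (Ideal.pow_mem_pow hI m)
  · have htJ := Ideal.sup_pow_add_le_pow_sup_pow (Ideal.pow_right_mono hle _ ht)
    rw [pow_one, Ideal.span_singleton_pow] at htJ
    obtain ⟨u, hu, v, hv, rfl⟩ := Submodule.mem_sup.mp htJ
    obtain ⟨c, rfl⟩ := Ideal.mem_span_singleton'.mp hv
    rw [smul_eq_mul, mul_add, show s * (c * h ^ m) = c * (h ^ m * s) by ring]
    exact J.add_mem (J.mul_mem_left _ hu) (J.mul_mem_left _ hs)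

lemma saturation_eq_under_map (hI : h ∈ I) (hle : I ≤ J ⊔ Ideal.span {h}) :
    saturation J I = (J.map (algebraMap R (Localization.Away h))).under R := by
  ext s
  rw [mem_saturation_iff hI hle, Ideal.mem_comap,
    IsLocalization.algebraMap_mem_map_algebraMap_iff (Submonoid.powers h)]
  exact ⟨fun ⟨m, hm⟩ => ⟨_, ⟨m, rfl⟩, hm⟩, fun ⟨_, ⟨m, rfl⟩, hs⟩ => ⟨m, hs⟩⟩

end Saturation

section TargetPoint
variable {k : Type*} [Field k] {n : ℕ} {W : Submodule k (MvPolynomial (Fin (n + 1)) k)}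

lemma TargetPoint.exists_mem_notMem (q : TargetPoint W) : ∃ h ∈ W, h ∉ q.space := by
  by_contra! hcon
  have hrank := q.finrank_add_one
  rw [le_antisymm q.space_le hcon] at hrank
  exact Nat.succ_ne_self _ hrank

lemma TargetPoint.space_sup_span_singleton [FiniteDimensional k W] (q : TargetPoint W)
    {h : MvPolynomial (Fin (n + 1)) k} (hW : h ∈ W) (hq : h ∉ q.space) :
    q.space ⊔ Submodule.span k {h} = W := by
  have hle : q.space ⊔ Submodule.span k {h} ≤ W :=
    sup_le q.space_le ((Submodule.span_singleton_le_iff_mem _ _).mpr hW)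
  have hlt : q.space < q.space ⊔ Submodule.span k {h} := lt_of_le_not_ge le_sup_left fun hle' =>
    hq (hle' (Submodule.mem_sup_right (Submodule.mem_span_singleton_self h)))
  have : FiniteDimensional k (q.space ⊔ Submodule.span k {h} : Submodule k _) :=
    Submodule.finiteDimensional_of_le hle
  refine Submodule.eq_of_le_of_finrank_le hle ?_
  rw [← q.finrank_add_one]
  exact Submodule.finrank_lt_finrank_of_lt hlt

end TargetPoint

section FormSpace
variable {k : Type*} [Field k] {n r d : ℕ} {f : Fin (r + 1) → MvPolynomial (Fin (n + 1)) k}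
  {h : MvPolynomial (Fin (n + 1)) k}

instance finiteDimensional_formSpace : FiniteDimensional k (formSpace f) :=
  FiniteDimensional.span_of_finite k (Set.finite_range f)

lemma mem_formSpace (f : Fin (r + 1) → MvPolynomial (Fin (n + 1)) k) (i : Fin (r + 1)) :
    f i ∈ formSpace f :=
  Submodule.subset_span ⟨i, rfl⟩

lemma exists_bind₁_eq_of_mem_formSpace (hW : h ∈ formSpace f) :
    ∃ l : MvPolynomial (Fin (r + 1)) k, l.IsHomogeneous 1 ∧ bind₁ f l = h := by
  obtain ⟨c, rfl⟩ := (Submodule.mem_span_range_iff_exists_fun k).mp hW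
  refine ⟨∑ j, C (c j) * X j, IsHomogeneous.sum _ _ _ fun j _ => isHomogeneous_C_mul_X _ _, ?_⟩
  simp only [map_sum, map_mul, bind₁_C_right, bind₁_X_right, smul_eq_C_mul]

lemma isHomogeneous_of_mem_formSpace (hf : ∀ i, (f i).IsHomogeneous d) (hW : h ∈ formSpace f) :
    h.IsHomogeneous d := by
  have hle : formSpace f ≤ homogeneousSubmodule (Fin (n + 1)) k d :=
    Submodule.span_le.mpr (Set.range_subset_iff.mpr hf)
  exact hle hW

lemma mem_formIdeal_of_mem_formSpace (hW : h ∈ formSpace f) : h ∈ formIdeal f :=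
  Submodule.span_le_restrictScalars k (MvPolynomial (Fin (n + 1)) k) _ hW

lemma exists_ne_zero_of_mem_formSpace (hW : h ∈ formSpace f) (hh : h ≠ 0) : ∃ i, f i ≠ 0 := by
  by_contra! hzero
  have hbot : formSpace f = ⊥ := Submodule.span_eq_bot.mpr (Set.forall_mem_range.mpr hzero)
  exact hh ((Submodule.mem_bot k).mp (hbot ▸ hW))

lemma formIdeal_le_sup (q : TargetPoint (formSpace f)) (hW : h ∈ formSpace f) (hq : h ∉ q.space) :
    formIdeal f ≤ q.ideal ⊔ Ideal.span {h} := by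
  refine Ideal.span_le.mpr (Set.range_subset_iff.mpr fun i => ?_)
  obtain ⟨u, hu, v, hv, huv⟩ :=
    Submodule.mem_sup.mp (q.space_sup_span_singleton hW hq ▸ mem_formSpace f i)
  exact huv ▸ Ideal.add_mem _ (Ideal.mem_sup_left (Ideal.subset_span hu))
    (Ideal.mem_sup_right (Submodule.span_le_restrictScalars k _ _ hv))

lemma mem_morphismFiberIdeal_iff {q : TargetPoint (formSpace f)} (hW : h ∈ formSpace f)
    (hq : h ∉ q.space) {s : MvPolynomial (Fin (n + 1)) k} :
    s ∈ morphismFiberIdeal f q ↔ ∃ m : ℕ, h ^ m * s ∈ q.ideal :=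
  mem_saturation_iff (mem_formIdeal_of_mem_formSpace hW) (formIdeal_le_sup q hW hq)

lemma morphismFiberIdeal_eq_under_map {q : TargetPoint (formSpace f)} (hW : h ∈ formSpace f)
    (hq : h ∉ q.space) : morphismFiberIdeal f q =
      (q.ideal.map (algebraMap _ (Localization.Away h))).under (MvPolynomial (Fin (n + 1)) k) :=
  saturation_eq_under_map (mem_formIdeal_of_mem_formSpace hW) (formIdeal_le_sup q hW hq)

lemma height_morphismFiberIdeal {q : TargetPoint (formSpace f)} (hW : h ∈ formSpace f)
    (hq : h ∉ q.space) : (morphismFiberIdeal f q).height =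
      (q.ideal.map (algebraMap _ (Localization.Away h))).height := by
  rw [morphismFiberIdeal_eq_under_map hW hq, IsLocalization.height_under (Submonoid.powers h)]

end FormSpace

section RatioHom
variable {k σ : Type*} [Field k] {r : ℕ} (f : Fin (r + 1) → MvPolynomial σ k) (h : MvPolynomial σ k)

instance finiteType_range_ratioHom : Algebra.FiniteType k (ratioHom f h).range :=
  .of_surjective (ratioHom f h).rangeRestrict (ratioHom f h).rangeRestrict_surjective

variable {l : MvPolynomial (Fin (r + 1)) k} {Q : Ideal (Localization.Away h)}

lemma algebraMap_bind₁_eq_mul_ratioHom (hl : l.IsHomogeneous 1) :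
    algebraMap _ (Localization.Away h) (bind₁ f l) = algebraMap _ _ h * ratioHom f h l := by
  rw [ratioHom_of_isHomogeneous f h hl, pow_one, ← mul_assoc, IsLocalization.Away.mul_invSelf,
    one_mul]

variable {f h}

lemma ratioHom_mem_of_algebraMap_bind₁_mem (hl : l.IsHomogeneous 1)
    (hQ : algebraMap _ (Localization.Away h) (bind₁ f l) ∈ Q) : ratioHom f h l ∈ Q := by
  rw [ratioHom_of_isHomogeneous f h hl]
  exact Ideal.mul_mem_left _ _ hQ

lemma algebraMap_bind₁_mem_map_under (hl : l.IsHomogeneous 1)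
    (hQ : algebraMap _ (Localization.Away h) (bind₁ f l) ∈ Q) :
    algebraMap _ (Localization.Away h) (bind₁ f l) ∈
      (Q.under (ratioHom f h).range).map (algebraMap _ _) := by
  rw [algebraMap_bind₁_eq_mul_ratioHom f h hl]
  exact Ideal.mul_mem_left _ _ <| Ideal.mem_map_of_mem (algebraMap (ratioHom f h).range _)
    (x := (ratioHom f h).rangeRestrict l) (ratioHom_mem_of_algebraMap_bind₁_mem hl hQ)

end RatioHom

section FibreHeights
variable {k : Type*} [Field k] {n r d : ℕ} {f : Fin (r + 1) → MvPolynomial (Fin (n + 1)) k}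
  {h : MvPolynomial (Fin (n + 1)) k}

lemma map_ideal_le_map_under_range_ratioHom (q : TargetPoint (formSpace f))
    {Q : Ideal (Localization.Away h)} (hQ : q.ideal.map (algebraMap _ _) ≤ Q) :
    q.ideal.map (algebraMap _ (Localization.Away h)) ≤
      (Q.under (ratioHom f h).range).map (algebraMap _ _) := by
  refine Ideal.map_le_iff_le_comap.mpr (Ideal.span_le.mpr fun w hw => ?_)
  obtain ⟨l, hl, rfl⟩ := exists_bind₁_eq_of_mem_formSpace (q.space_le hw)
  exact algebraMap_bind₁_mem_map_under hl (hQ (Ideal.mem_map_of_mem _ (Ideal.subset_span hw)))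

lemma height_map_ideal_le (hh : h ≠ 0) {q : TargetPoint (formSpace f)}
    (hne : q.ideal.map (algebraMap _ (Localization.Away h)) ≠ ⊤) :
    ((q.ideal.map (algebraMap _ (Localization.Away h))).height : WithBot ℕ∞) ≤
      ringKrullDim (ratioHom f h).range := by
  have : IsDomain (Localization.Away h) := IsLocalization.isDomain_localization
    (powers_le_nonZeroDivisors_of_noZeroDivisors hh)
  have : IsNoetherianRing (ratioHom f h).range := Algebra.FiniteType.isNoetherianRing k _
  obtain ⟨Q, hQ⟩ := Ideal.nonempty_minimalPrimes hne
  have : Q.IsPrime := hQ.isPrime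
  calc ((q.ideal.map (algebraMap _ (Localization.Away h))).height : WithBot ℕ∞)
      ≤ Q.height := WithBot.coe_le_coe.mpr (Ideal.height_mono hQ.le)
    _ ≤ (Q.under (ratioHom f h).range).height := WithBot.coe_le_coe.mpr <|
        height_le_height_under_of_mem_minimalPrimes hQ
          (map_ideal_le_map_under_range_ratioHom q hQ.le)
    _ ≤ ringKrullDim (ratioHom f h).range := Ideal.height_le_ringKrullDim_of_isPrime

lemma height_morphismFiberIdeal_le {q : TargetPoint (formSpace f)}
    (hne : morphismFiberIdeal f q ≠ ⊤) : ((morphismFiberIdeal f q).height : WithBot ℕ∞) ≤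
      topologicalKrullDim (closure (ratImage f)) := by
  obtain ⟨h, hW, hq⟩ := q.exists_mem_notMem
  have hh : h ≠ 0 := fun h0 => hq (h0 ▸ q.space.zero_mem)
  rw [morphismFiberIdeal_eq_under_map hW hq, Ne, Ideal.comap_eq_top_iff] at hne
  rw [height_morphismFiberIdeal hW hq]
  obtain ⟨l, hl, rfl⟩ := exists_bind₁_eq_of_mem_formSpace hW
  exact (height_map_ideal_le hh hne).trans
    (ringKrullDim_range_ratioHom_le (exists_ne_zero_of_mem_formSpace hW hh) hl)

end FibreHeights

section GeneralPoints
variable {k : Type*} [Field k] {n : ℕ} {P Q : Projectivization k (Fin (n + 1) → k) → Prop}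

lemma ForGeneralPoint.mono (h : ForGeneralPoint P) (hPQ : ∀ p, P p → Q p) : ForGeneralPoint Q :=
  let ⟨g, e, hg0, hg, hP⟩ := h
  ⟨g, e, hg0, hg, fun p hp => hPQ p (hP p hp)⟩

lemma forGeneralPoint_forall {ι : Type*} [Finite ι]
    {P : ι → Projectivization k (Fin (n + 1) → k) → Prop} (h : ∀ i, ForGeneralPoint (P i)) :
    ForGeneralPoint fun p => ∀ i, P i p := by
  have := Fintype.ofFinite ι
  choose g e hg0 hg hP using h
  refine ⟨∏ i, g i, ∑ i, e i, Finset.prod_ne_zero_iff.mpr fun i _ => hg0 i,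
    IsHomogeneous.prod _ _ _ fun i _ => hg i, fun p hp i => hP i p fun hpi => hp ?_⟩
  rw [map_prod]
  exact Finset.prod_eq_zero (Finset.mem_univ i) hpi

lemma ForGeneralPoint.and (hP : ForGeneralPoint P) (hQ : ForGeneralPoint Q) :
    ForGeneralPoint fun p => P p ∧ Q p :=
  (forGeneralPoint_forall (P := fun b : Bool => bif b then P else Q)
    (Bool.forall_bool.mpr ⟨hQ, hP⟩)).mono fun _ h => ⟨h true, h false⟩

lemma forGeneralPoint_eval_ne_zero {g : MvPolynomial (Fin (n + 1)) k} {e : ℕ} (hg0 : g ≠ 0)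
    (hg : g.IsHomogeneous e) :
    ForGeneralPoint fun p : Projectivization k (Fin (n + 1) → k) => eval p.rep g ≠ 0 :=
  ⟨g, e, hg0, hg, fun _ hp => hp⟩

lemma forGeneralPoint_of_forall (h : ∀ p, P p) : ForGeneralPoint P :=
  ⟨1, 0, one_ne_zero, isHomogeneous_one _ _, fun p _ => h p⟩

end GeneralPoints

section GeneralFibres
variable {k : Type*} [Field k] {n r d : ℕ} {f : Fin (r + 1) → MvPolynomial (Fin (n + 1)) k}

lemma isMaximal_of_forall_exists_sub_algebraMap_mem {B : Type*} [CommRing B] [Algebra k B]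
    {Q : Ideal B} (hQ : Q ≠ ⊤) (h : ∀ b, ∃ c : k, b - algebraMap k B c ∈ Q) : Q.IsMaximal := by
  have : Nontrivial (B ⧸ Q) := Ideal.Quotient.nontrivial_iff.mpr hQ
  have hsurj : Function.Surjective (algebraMap k (B ⧸ Q)) :=
    Ideal.Quotient.mk_surjective.forall.mpr fun b =>
      (h b).imp fun c hc => (Ideal.Quotient.eq.mpr hc).symm
  exact Ideal.Quotient.maximal_of_isField Q <| (RingEquiv.ofBijective _
    ⟨(algebraMap k (B ⧸ Q)).injective, hsurj⟩).symm.toMulEquiv.isField (Field.toIsField k)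

lemma le_height_of_forall_isPrime {R : Type*} [CommRing R] {J : Ideal R} {N : WithBot ℕ∞}
    (h : ∀ Q : Ideal R, Q.IsPrime → J ≤ Q → N ≤ Q.height) : N ≤ J.height := by
  induction N using WithBot.recBotCoe with
  | bot => exact bot_le
  | coe N =>
    rw [Ideal.height_eq_inf_minimalPrimes]
    exact WithBot.coe_le_coe.mpr <| le_iInf₂ fun Q hQ =>
      WithBot.coe_le_coe.mp (h Q hQ.isPrime hQ.le)

lemma eval_bind₁ (v : Fin (n + 1) → k) (G : MvPolynomial (Fin (r + 1)) k) :
    eval v (bind₁ f G) = eval (fun j => eval v (f j)) G := by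
  rw [← aeval_eq_eval, ← aeval_eq_eval, aeval_bind₁]

variable {p : Projectivization k (Fin (n + 1) → k)}

lemma mem_imagePoint_space (hp : IsRegularAt f p) {w : MvPolynomial (Fin (n + 1)) k} :
    w ∈ (imagePoint f p hp).space ↔ w ∈ formSpace f ∧ eval p.rep w = 0 := by
  rw [imagePoint, Submodule.mem_inf, LinearMap.mem_ker]
  rfl

lemma notMem_imagePoint_space {i : Fin (r + 1)} (hi : eval p.rep (f i) ≠ 0)
    (hp : IsRegularAt f p) : f i ∉ (imagePoint f p hp).space :=
  fun h => hi ((mem_imagePoint_space hp).mp h).2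

lemma ideal_imagePoint_le (hf : ∀ i, (f i).IsHomogeneous d) (hp : IsRegularAt f p) :
    (imagePoint f p hp).ideal ≤ pointIdeal p.rep := by
  refine Ideal.span_le.mpr fun w hw => ?_
  obtain ⟨hw, h0⟩ := (mem_imagePoint_space hp).mp hw
  exact mem_pointIdeal_of_isHomogeneous p.rep_nonzero (isHomogeneous_of_mem_formSpace hf hw) h0

lemma morphismFiberIdeal_imagePoint_le (hf : ∀ i, (f i).IsHomogeneous d) (hp : IsRegularAt f p) :
    morphismFiberIdeal f (imagePoint f p hp) ≤ pointIdeal p.rep := by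
  obtain ⟨i, hi⟩ := id hp
  intro s hs
  obtain ⟨m, hm⟩ := (mem_morphismFiberIdeal_iff (mem_formSpace f i)
    (notMem_imagePoint_space hi hp)).mp hs
  have hprime := isPrime_pointIdeal p.rep_nonzero
  exact (hprime.mem_or_mem (ideal_imagePoint_le hf hp hm)).resolve_left fun h =>
    hi (eval_eq_zero_of_mem_pointIdeal (hprime.mem_of_pow_mem m h))

lemma morphismFiberIdeal_imagePoint_ne_top (hf : ∀ i, (f i).IsHomogeneous d)
    (hp : IsRegularAt f p) : morphismFiberIdeal f (imagePoint f p hp) ≠ ⊤ :=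
  ne_top_of_le_ne_top (isPrime_pointIdeal p.rep_nonzero).ne_top
    (morphismFiberIdeal_imagePoint_le hf hp)

lemma ratioHom_sub_algebraMap_eval_mem {i : Fin (r + 1)} (hi : eval p.rep (f i) ≠ 0)
    (hp : IsRegularAt f p) {Q : Ideal (Localization.Away (f i))}
    (hQ : (imagePoint f p hp).ideal.map (algebraMap _ _) ≤ Q) (H : MvPolynomial (Fin (r + 1)) k) :
    ratioHom f (f i) H -
      algebraMap k _ (eval (fun j => (eval p.rep (f i))⁻¹ * eval p.rep (f j)) H) ∈ Q := by
  set c : Fin (r + 1) → k := fun j => (eval p.rep (f i))⁻¹ * eval p.rep (f j) with hc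
  have hvar (j : Fin (r + 1)) : ratioHom f (f i) (X j) - algebraMap k _ (c j) ∈ Q := by
    have hspace : bind₁ f (X j - C (c j) * X i) ∈ (imagePoint f p hp).space := by
      rw [map_sub, map_mul, bind₁_X_right, bind₁_X_right, bind₁_C_right, ← smul_eq_C_mul]
      refine (mem_imagePoint_space hp).mpr ⟨Submodule.sub_mem _ (mem_formSpace f j)
        (Submodule.smul_mem _ _ (mem_formSpace f i)), ?_⟩
      rw [map_sub, smul_eval, hc, mul_right_comm, inv_mul_cancel₀ hi, one_mul, sub_self]
    have hmem := ratioHom_mem_of_algebraMap_bind₁_mem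
      ((isHomogeneous_X k j).sub (isHomogeneous_C_mul_X _ _))
      (hQ (Ideal.mem_map_of_mem _ (Ideal.subset_span hspace)))
    rwa [map_sub, map_mul, ratioHom_X_self, mul_one, algHom_C] at hmem
  have heq : (Ideal.Quotient.mkₐ k Q).comp (ratioHom f (f i)) =
      (Algebra.ofId k (_ ⧸ Q)).comp (aeval c) := by
    ext1 j
    rw [AlgHom.comp_apply, AlgHom.comp_apply, aeval_X]
    exact Ideal.Quotient.eq.mpr (hvar j)
  exact Ideal.Quotient.eq.mp (DFunLike.congr_fun heq H)

lemma forGeneralPoint_ringKrullDim_le_height (hf : ∀ i, (f i).IsHomogeneous d) {i : Fin (r + 1)}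
    (hi : f i ≠ 0) :
    ForGeneralPoint fun p : Projectivization k (Fin (n + 1) → k) => ∀ hp : IsRegularAt f p,
      ringKrullDim (ratioHom f (f i)).range ≤
        ((morphismFiberIdeal f (imagePoint f p hp)).height : WithBot ℕ∞) := by
  have : IsDomain (Localization.Away (f i)) := IsLocalization.isDomain_localization
    (powers_le_nonZeroDivisors_of_noZeroDivisors hi)
  obtain ⟨b, hb, hdim⟩ := exists_ne_zero_forall_ringKrullDim_le_height k (ratioHom f (f i)).range
    (Localization.Away (f i))
  obtain ⟨G, rfl⟩ := (ratioHom f (f i)).rangeRestrict_surjective b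
  have hH := isHomogeneous_homogenize (isHomogeneous_X k i) G
  have hH0 : bind₁ f (homogenize (X i) G) ≠ 0 := by
    rw [Ne, ← ratioHom_eq_zero_iff f hi hH, map_homogenize _ (ratioHom_X_self f i)]
    exact fun h => hb (Subtype.ext h)
  refine ((forGeneralPoint_eval_ne_zero hH0 (hH.aeval f hf)).and
    (forGeneralPoint_eval_ne_zero hi (hf i))).mono fun p ⟨hpG, hpi⟩ hp => ?_
  have hcG : eval (fun j => (eval p.rep (f i))⁻¹ * eval p.rep (f j)) G ≠ 0 := by
    rw [← aeval_eq_eval, ← map_homogenize (aeval _) (aeval_X _ i |>.trans (inv_mul_cancel₀ hpi)),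
      aeval_mul_left_of_isHomogeneous hH]
    exact mul_ne_zero (pow_ne_zero _ (inv_ne_zero hpi)) (eval_bind₁ (f := f) _ _ ▸ hpG)
  rw [height_morphismFiberIdeal (mem_formSpace f i) (notMem_imagePoint_space hpi hp)]
  refine le_height_of_forall_isPrime fun Q hQ hle => ?_
  have hval := ratioHom_sub_algebraMap_eval_mem hpi hp hle
  refine hdim Q hQ (isMaximal_of_forall_exists_sub_algebraMap_mem (k := k)
    (hQ.under (ratioHom f (f i)).range).ne_top ?_) fun hGQ => hQ.ne_top ?_
  · exact (ratioHom f (f i)).rangeRestrict_surjective.forall.mpr fun H => ⟨_, hval H⟩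
  · exact Ideal.eq_top_of_isUnit_mem _ ((Submodule.sub_mem_iff_right _ hGQ).mp (hval G))
      (hcG.isUnit.map (algebraMap k _))

lemma forGeneralPoint_topologicalKrullDim_eq (hf : ∀ i, (f i).IsHomogeneous d)
    (hne : ∃ i, f i ≠ 0) :
    ForGeneralPoint fun p : Projectivization k (Fin (n + 1) → k) => ∃ hp : IsRegularAt f p,
      topologicalKrullDim (closure (ratImage f)) =
        ((morphismFiberIdeal f (imagePoint f p hp)).height : WithBot ℕ∞) := by
  have hcharts : ForGeneralPoint fun p : Projectivization k (Fin (n + 1) → k) =>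
      ∀ i, f i ≠ 0 → ∀ hp : IsRegularAt f p, ringKrullDim (ratioHom f (f i)).range ≤
        ((morphismFiberIdeal f (imagePoint f p hp)).height : WithBot ℕ∞) := by
    refine forGeneralPoint_forall fun i => ?_
    by_cases hi : f i = 0
    · exact forGeneralPoint_of_forall fun _ h => absurd hi h
    · exact (forGeneralPoint_ringKrullDim_le_height hf hi).mono fun _ h _ => h
  obtain ⟨i, hi⟩ := id hne
  refine (hcharts.and (forGeneralPoint_eval_ne_zero hi (hf i))).mono fun p ⟨hdim, hpi⟩ =>
    ⟨⟨i, hpi⟩, le_antisymm ?_ ?_⟩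
  · exact topologicalKrullDim_closure_ratImage_le hne fun j hj => hdim j hj ⟨i, hpi⟩
  · exact height_morphismFiberIdeal_le (morphismFiberIdeal_imagePoint_ne_top hf _)

end GeneralFibres

section Forms

lemma isHomogeneous_det {R σ m : Type*} [CommRing R] [Fintype m] [DecidableEq m]
    {M : Matrix m m (MvPolynomial σ R)} {d : ℕ} (hM : ∀ a b, (M a b).IsHomogeneous d) :
    M.det.IsHomogeneous (Fintype.card m * d) := by
  rw [Matrix.det_apply]
  refine IsHomogeneous.sum _ _ _ fun s _ => ?_
  have hprod := IsHomogeneous.prod Finset.univ (fun i => M (s i) i) (fun _ => d) fun i _ => hM _ _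
  rw [Finset.sum_const, smul_eq_mul, Finset.card_univ] at hprod
  rcases Int.units_eq_one_or s.sign with hs | hs
  · rwa [hs, one_smul]
  · rw [hs, Units.neg_smul, one_smul]
    exact hprod.neg

lemma homogeneousComponent_mul_add_of_right_mem {R σ : Type*} [CommSemiring R] {d : ℕ}
    {w : MvPolynomial σ R} (hw : w.IsHomogeneous d) (e : ℕ) (a : MvPolynomial σ R) :
    homogeneousComponent (e + d) (a * w) = homogeneousComponent e a * w := by
  rw [← decomposition.decompose'_apply, ← decomposition.decompose'_apply]
  exact DirectSum.coe_decompose_mul_add_of_right_mem (homogeneousSubmodule σ R) hw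

variable {k : Type*} [Field k] {n d : ℕ}

lemma exists_eq_sum_mul_X_of_mem_span {V : Submodule k (MvPolynomial (Fin (n + 1)) k)}
    (hV : ∀ w ∈ V, w.IsHomogeneous d) {s : MvPolynomial (Fin (n + 1)) k}
    (hs : s ∈ Ideal.span (V : Set (MvPolynomial (Fin (n + 1)) k))) (hd : s.IsHomogeneous (1 + d)) :
    ∃ w : Fin (n + 1) → MvPolynomial (Fin (n + 1)) k, (∀ b, w b ∈ V) ∧ s = ∑ b, w b * X b := by
  obtain ⟨N, a, w, rfl⟩ := Submodule.mem_span_set'.mp hs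
  choose c hc using fun i => exists_linearForm_eq (homogeneousComponent_isHomogeneous 1 (a i))
  refine ⟨fun b => ∑ i, c i b • (w i : MvPolynomial (Fin (n + 1)) k),
    fun b => Submodule.sum_mem _ fun i _ => Submodule.smul_mem _ _ (w i).2, ?_⟩
  rw [← homogeneousComponent_eq_self hd, map_sum]
  simp_rw [Finset.sum_mul]
  rw [Finset.sum_comm]
  refine Finset.sum_congr rfl fun i _ => ?_
  rw [smul_eq_mul, homogeneousComponent_mul_add_of_right_mem (hV _ (w i).2), ← hc, linearForm,
    Fintype.linearCombination_apply, Finset.sum_mul]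
  exact Finset.sum_congr rfl fun b _ => by rw [smul_mul_assoc, smul_mul_assoc, mul_comm]

end Forms

section Birational
variable {k : Type*} [Field k] {n r d e : ℕ} {f : Fin (r + 1) → MvPolynomial (Fin (n + 1)) k}
  {g : Fin (n + 1) → MvPolynomial (Fin (r + 1)) k}

lemma X_pow_mul_bind₁_bind₁ (hmul : ∀ i j, bind₁ f (g i) * X j = bind₁ f (g j) * X i)
    {w : MvPolynomial (Fin (n + 1)) k} (hw : w.IsHomogeneous d) (i : Fin (n + 1)) :
    X i ^ d * bind₁ f (bind₁ g w) = bind₁ f (g i) ^ d * w := by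
  rw [bind₁_bind₁, bind₁, ← aeval_mul_left_of_isHomogeneous hw]
  simp_rw [mul_comm (X i : MvPolynomial (Fin (n + 1)) k), hmul _ i]
  rw [aeval_mul_left_of_isHomogeneous hw, aeval_X_left_apply]

lemma isBirationalOntoImage_of_mul_X_eq (hf : ∀ i, (f i).IsHomogeneous d) (hne : ∃ i, f i ≠ 0)
    (hg : ∀ i, (g i).IsHomogeneous e)
    (hmul : ∀ i j, bind₁ f (g i) * X j = bind₁ f (g j) * X i) {i : Fin (n + 1)}
    (hi : bind₁ f (g i) ≠ 0) : IsBirationalOntoImage f := by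
  have hX : (X i : MvPolynomial (Fin (n + 1)) k) ^ d ≠ 0 := pow_ne_zero _ (X_ne_zero _)
  have hcomp (j) : X i ^ d * bind₁ f (bind₁ g (f j)) = bind₁ f (g i) ^ d * f j :=
    X_pow_mul_bind₁_bind₁ hmul (hf j) i
  have hgf (j) : (bind₁ g (f j)).IsHomogeneous (e * d) := (hf j).aeval g hg
  obtain ⟨j, hj⟩ := id hne
  have hgfj : bind₁ g (f j) ∉ imageIdeal f := fun h => by
    have hzero := hcomp j
    rw [(mem_imageIdeal_iff hne (hgf j)).mp h, mul_zero] at hzero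
    exact mul_ne_zero (pow_ne_zero _ hi) hj hzero.symm
  have hXj : X j ∉ imageIdeal f := fun h =>
    hj (bind₁_X_right f j ▸ (mem_imageIdeal_iff hne (isHomogeneous_X k j)).mp h)
  have hprop (a b) : bind₁ g (f a) * X b - bind₁ g (f b) * X a ∈ imageIdeal f := by
    refine (mem_imageIdeal_iff hne (((hgf a).mul (isHomogeneous_X k b)).sub
      ((hgf b).mul (isHomogeneous_X k a)))).mpr (mul_left_cancel₀ hX ?_)
    rw [map_sub, map_mul, map_mul, bind₁_X_right, bind₁_X_right]
    linear_combination f b * hcomp a - f a * hcomp b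
  exact ⟨g, ⟨⟨e, hg⟩, i, fun h => hi ((mem_imageIdeal_iff hne (hg i)).mp h)⟩,
    ⟨⟨⟨d * e, fun a => (hg a).aeval f hf⟩, i, hi⟩, ⟨⟨1, isHomogeneous_X k⟩, i, X_ne_zero _⟩,
      fun a b => sub_eq_zero.mpr (hmul a b)⟩,
    ⟨⟨⟨e * d, hgf⟩, j, hgfj⟩, ⟨⟨1, isHomogeneous_X k⟩, j, hXj⟩, hprop⟩⟩

end Birational

section RowIdeal

lemma smul_cramer_eq_det_smul {R m : Type*} [CommRing R] [Fintype m] [DecidableEq m]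
    {N : Matrix m m R} {x v : m → R} {c : R} (h : N.mulVec x = c • v) :
    c • N.cramer v = N.det • x := by
  rw [← map_smul, ← h, Matrix.cramer_eq_adjugate_mulVec, Matrix.mulVec_mulVec,
    Matrix.adjugate_mul, Matrix.smul_mulVec, Matrix.one_mulVec]

variable {k : Type*} [Field k] {n r d : ℕ} {f : Fin (r + 1) → MvPolynomial (Fin (n + 1)) k}

lemma exists_bind₁_eq_cramer {N : Matrix (Fin (n + 1)) (Fin (n + 1)) (MvPolynomial (Fin (n + 1)) k)}
    (hN : ∀ a b, N a b ∈ formSpace f) {u : Fin (n + 1) → MvPolynomial (Fin (n + 1)) k}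
    (hu : ∀ a, u a ∈ formSpace f) :
    ∃ g : Fin (n + 1) → MvPolynomial (Fin (r + 1)) k, (∀ a, (g a).IsHomogeneous (n + 1)) ∧
      ∀ a, bind₁ f (g a) = N.cramer u a := by
  choose M hM hMN using fun a b => exists_bind₁_eq_of_mem_formSpace (hN a b)
  choose v hv hvu using fun a => exists_bind₁_eq_of_mem_formSpace (hu a)
  refine ⟨Matrix.cramer (Matrix.of M) v, fun a => ?_, fun a => ?_⟩
  · have hcol (i j) : ((Matrix.of M).updateCol a v i j).IsHomogeneous 1 := by
      rw [Matrix.updateCol_apply]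
      split_ifs
      exacts [hv i, hM i j]
    simpa only [Matrix.cramer_apply, Fintype.card_fin, mul_one] using isHomogeneous_det hcol
  · rw [Matrix.cramer_apply, Matrix.cramer_apply, AlgHom.map_det]
    refine congrArg Matrix.det (Matrix.ext fun i j => ?_)
    rw [AlgHom.mapMatrix_apply, Matrix.map_apply, Matrix.updateCol_apply, Matrix.updateCol_apply]
    split_ifs
    exacts [hvu i, hMN i j]

/- Cramer's rule inverts `φ`: the maximal minors of `(N | u)` are forms in the `f_i` that are
proportional to the coordinates. -/
lemma isBirationalOntoImage_of_mulVec_eq (hf : ∀ i, (f i).IsHomogeneous d)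
    {N : Matrix (Fin (n + 1)) (Fin (n + 1)) (MvPolynomial (Fin (n + 1)) k)}
    (hN : ∀ a b, N a b ∈ formSpace f) {u : Fin (n + 1) → MvPolynomial (Fin (n + 1)) k}
    (hu : ∀ a, u a ∈ formSpace f) {a₀ : Fin (n + 1)}
    (h : N.mulVec X = (X a₀ : MvPolynomial (Fin (n + 1)) k) • u) (hdet : N.det ≠ 0) :
    IsBirationalOntoImage f := by
  obtain ⟨g, hg, hgN⟩ := exists_bind₁_eq_cramer hN hu
  have hcramer (a) : X a₀ * bind₁ f (g a) = N.det * X a := by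
    rw [hgN]
    exact congrFun (smul_cramer_eq_det_smul h) a
  have hX : (X a₀ : MvPolynomial (Fin (n + 1)) k) ≠ 0 := X_ne_zero _
  have hne : ∃ i, f i ≠ 0 := by
    obtain ⟨a, ha⟩ : ∃ a, N 0 a ≠ 0 := by
      by_contra! hrow
      exact hdet (Matrix.det_eq_zero_of_row_eq_zero 0 hrow)
    exact exists_ne_zero_of_mem_formSpace (hN 0 a) ha
  refine isBirationalOntoImage_of_mul_X_eq (i := a₀) hf hne hg (fun a b => ?_) fun hzero => ?_
  · refine mul_left_cancel₀ hX ?_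
    linear_combination X b * hcramer a - X a * hcramer b
  · refine mul_ne_zero hdet hX ?_
    rw [← hcramer, hzero, mul_zero]

lemma ideal_le_rowIdeal (f : Fin (r + 1) → MvPolynomial (Fin (n + 1)) k)
    (q : TargetPoint (formSpace f)) : q.ideal ≤ rowIdeal f q := fun _ hs =>
  Submodule.mem_colon.mpr fun _ _ => Ideal.mul_mem_right _ _ hs

lemma det_diagonal_sub_ne_zero {R K m : Type*} [CommRing R] [CommRing K] [IsDomain K] [Fintype m]
    [DecidableEq m] (φ : R →+* K) {v : m → R} {w : Matrix m m R} (hv : ∀ a, φ (v a) ≠ 0)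
    (hw : ∀ a b, φ (w a b) = 0) : (Matrix.diagonal v - w).det ≠ 0 := by
  have hmap : φ.mapMatrix (Matrix.diagonal v - w) = Matrix.diagonal fun a => φ (v a) := by
    ext a b
    simp [Matrix.diagonal_apply, hw, apply_ite φ]
  intro hdet
  have hprod := congrArg φ hdet
  rw [RingHom.map_det, hmap, Matrix.det_diagonal, map_zero, Finset.prod_eq_zero_iff] at hprod
  obtain ⟨a, -, ha⟩ := hprod
  exact hv a ha

lemma isBirationalOntoImage_of_rowIdeal (hf : ∀ i, (f i).IsHomogeneous d)
    {q : TargetPoint (formSpace f)} (hlin : IsLinearIdeal (rowIdeal f q))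
    (hheight : (rowIdeal f q).height = n) (hle : ¬ formIdeal f ≤ rowIdeal f q) :
    IsBirationalOntoImage f := by
  obtain ⟨p, hp, hpq⟩ := exists_eq_pointIdeal hlin hheight
  obtain ⟨a₀, ha₀⟩ : ∃ a, p a ≠ 0 := Function.ne_iff.mp hp
  obtain ⟨h, hW, hq⟩ := q.exists_mem_notMem
  have hqp : q.ideal ≤ pointIdeal p := hpq ▸ ideal_le_rowIdeal f q
  have hhp : eval p h ≠ 0 := fun h0 => hle <| (formIdeal_le_sup q hW hq).trans <| by
    rw [hpq, sup_le_iff, Ideal.span_singleton_le_iff_mem]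
    exact ⟨hqp, mem_pointIdeal_of_isHomogeneous hp (isHomogeneous_of_mem_formSpace hf hW) h0⟩
  have hgen (a) : (C (p a₀) * X a - C (p a) * X a₀) * h ∈ q.ideal :=
    Submodule.mem_colon.mp (hpq.ge (C_mul_X_sub_mem_pointIdeal p a₀ a)) h
      (mem_formIdeal_of_mem_formSpace hW)
  choose w hwq hw using fun a => exists_eq_sum_mul_X_of_mem_span
    (fun _ h => isHomogeneous_of_mem_formSpace hf (q.space_le h)) (hgen a)
    (((isHomogeneous_C_mul_X _ _).sub (isHomogeneous_C_mul_X _ _)).mul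
      (isHomogeneous_of_mem_formSpace hf hW))
  refine isBirationalOntoImage_of_mulVec_eq hf (a₀ := a₀) (u := fun a => p a • h)
    (N := Matrix.diagonal (fun _ => p a₀ • h) - Matrix.of w) (fun a b => ?_)
    (fun a => Submodule.smul_mem _ _ hW) (funext fun a => ?_) fun hdet => ?_
  · refine Submodule.sub_mem _ ?_ (q.space_le (hwq a b))
    rw [Matrix.diagonal_apply]
    split_ifs
    exacts [Submodule.smul_mem _ _ hW, Submodule.zero_mem _]
  · rw [Matrix.sub_mulVec, Pi.sub_apply, Matrix.mulVec_diagonal, Pi.smul_apply, smul_eq_mul,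
      smul_eq_C_mul, smul_eq_C_mul]
    have hwa : (Matrix.of w).mulVec X a = _ := (hw a).symm
    rw [hwa]
    ring
  · refine det_diagonal_sub_ne_zero (eval p) (fun _ => ?_) (fun a b => ?_) hdet
    · rw [smul_eval]
      exact mul_ne_zero ha₀ hhp
    · exact eval_eq_zero_of_mem_pointIdeal (hqp (Ideal.subset_span (hwq a b)))

end RowIdeal

section FibresOfBirationalMaps
variable {k : Type*} [Field k] {n r d e : ℕ} {f : Fin (r + 1) → MvPolynomial (Fin (n + 1)) k}
  {g : Fin (n + 1) → MvPolynomial (Fin (r + 1)) k}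

lemma pointIdeal_le_morphismFiberIdeal_imagePoint {p : Projectivization k (Fin (n + 1) → k)}
    (hg : ∀ a, (g a).IsHomogeneous e)
    (hmul : ∀ a b, bind₁ f (g a) * X b = bind₁ f (g b) * X a)
    {a₀ : Fin (n + 1)} (hp₀ : eval p.rep (bind₁ f (g a₀)) ≠ 0) (hp : IsRegularAt f p) :
    pointIdeal p.rep ≤ morphismFiberIdeal f (imagePoint f p hp) := by
  obtain ⟨i, hi⟩ := id hp
  set γ : Fin (n + 1) → k :=
    fun a => eval (fun j => (eval p.rep (f i))⁻¹ * eval p.rep (f j)) (g a) with hγ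
  have hγ_eq (a) : γ a = (eval p.rep (f i))⁻¹ ^ e * eval p.rep (bind₁ f (g a)) := by
    simp only [hγ, eval_bind₁, ← aeval_eq_eval]
    exact aeval_mul_left_of_isHomogeneous (hg a) _ _
  have hγ₀ : γ a₀ ≠ 0 := hγ_eq a₀ ▸ mul_ne_zero (pow_ne_zero _ (inv_ne_zero hi)) hp₀
  have hrep : p.rep = (p.rep a₀ / γ a₀) • γ := by
    funext a
    have heval := congrArg (eval p.rep) (hmul a a₀)
    rw [map_mul, map_mul, eval_X, eval_X] at heval
    rw [Pi.smul_apply, smul_eq_mul, div_mul_eq_mul_div, eq_div_iff hγ₀, hγ_eq, hγ_eq]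
    linear_combination -(eval p.rep (f i))⁻¹ ^ e * heval
  have hscalar : p.rep a₀ / γ a₀ ≠ 0 := fun h => p.rep_nonzero (by rw [hrep, h, zero_smul])
  rw [hrep, pointIdeal_smul hscalar, pointIdeal_le_iff]
  intro a b
  rw [morphismFiberIdeal_eq_under_map (mem_formSpace f i) (notMem_imagePoint_space hi hp),
    Ideal.mem_comap]
  let x (c) : Localization.Away (f i) := algebraMap (MvPolynomial (Fin (n + 1)) k) _ (X c)
  have hratio (c) := ratioHom_sub_algebraMap_eval_mem hi hp le_rfl (g c)
  have hcross : ratioHom f (f i) (g a) * x b = ratioHom f (f i) (g b) * x a := by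
    rw [ratioHom_of_isHomogeneous f _ (hg a), ratioHom_of_isHomogeneous f _ (hg b), mul_assoc,
      mul_assoc, ← map_mul, ← map_mul, hmul]
  convert Ideal.sub_mem _ (Ideal.mul_mem_right (x a) _ (hratio b))
    (Ideal.mul_mem_right (x b) _ (hratio a)) using 1
  rw [map_sub, map_mul, map_mul, ← algebraMap_eq k (Fin (n + 1)), ← IsScalarTower.algebraMap_apply,
    ← IsScalarTower.algebraMap_apply]
  linear_combination hcross

lemma IsBirationalOntoImage.forGeneralPoint (hf : ∀ i, (f i).IsHomogeneous d)
    (hne : ∃ i, f i ≠ 0) (hbir : IsBirationalOntoImage f) :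
    ForGeneralPoint fun p : Projectivization k (Fin (n + 1) → k) => ∃ hp : IsRegularAt f p,
      morphismFiberIdeal f (imagePoint f p hp) = pointIdeal p.rep := by
  obtain ⟨i, hi⟩ := hne
  obtain ⟨g, ⟨⟨e, hg⟩, -⟩, ⟨⟨-, a, ha⟩, -, hmul⟩, -⟩ := hbir
  refine ((forGeneralPoint_eval_ne_zero hi (hf i)).and
    (forGeneralPoint_eval_ne_zero ha ((hg a).aeval f hf))).mono fun p ⟨hpi, hpa⟩ => ⟨⟨i, hpi⟩, ?_⟩
  exact le_antisymm (morphismFiberIdeal_imagePoint_le hf _)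
    (pointIdeal_le_morphismFiberIdeal_imagePoint hg (fun a b => sub_eq_zero.mp (hmul a b)) hpa _)

end FibresOfBirationalMaps

section GeneralPointExists
variable {k : Type*} [Field k] [Infinite k] {n : ℕ}
  {P : Projectivization k (Fin (n + 1) → k) → Prop}

lemma ForGeneralPoint.exists (h : ForGeneralPoint P) : ∃ p, P p := by
  obtain ⟨g, e, hg0, hg, hP⟩ := h
  obtain ⟨v, hv⟩ : ∃ v, eval v (X 0 * g) ≠ 0 := by
    by_contra! hzero
    exact mul_ne_zero (X_ne_zero 0) hg0 (MvPolynomial.funext fun v => by rw [hzero, map_zero])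
  rw [map_mul, eval_X] at hv
  have hv0 : v ≠ 0 := fun h => left_ne_zero_of_mul hv (congrFun h 0)
  obtain ⟨c, hc⟩ := Projectivization.exists_smul_eq_mk_rep k v hv0
  refine ⟨Projectivization.mk k v hv0, hP _ ?_⟩
  have heval : eval (c • v) g = (c : k) ^ e * eval v g :=
    aeval_mul_left_of_isHomogeneous hg (c : k) v
  rw [← hc, heval]
  exact mul_ne_zero (pow_ne_zero _ c.ne_zero) (right_ne_zero_of_mul hv)

end GeneralPointExists

section Dehomogenization
variable {k : Type*} [Field k] {n e : ℕ} {s : MvPolynomial (Fin (n + 1)) k}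

/-- The substitution `x_0 = 1`, which turns forms into functions on the affine chart `x_0 ≠ 0` of
`P^n`. -/
def dehomogenize : MvPolynomial (Fin (n + 1)) k →ₐ[k] MvPolynomial (Fin n) k :=
  aeval (Fin.cons 1 X)

@[simp]
lemma dehomogenize_X_zero : dehomogenize (X 0 : MvPolynomial (Fin (n + 1)) k) = 1 := by
  rw [dehomogenize, aeval_X, Fin.cons_zero]

@[simp]
lemma dehomogenize_X_succ (a : Fin n) :
    dehomogenize (X a.succ : MvPolynomial (Fin (n + 1)) k) = X a := by
  rw [dehomogenize, aeval_X, Fin.cons_succ]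

/-- The affine coordinates of a rational point of the chart `x_0 ≠ 0` of `P^n`; the zero vector if
`p` lies outside the chart. -/
def affineCoords (p : Projectivization k (Fin (n + 1) → k)) (a : Fin n) : k :=
  (p.rep 0)⁻¹ * p.rep a.succ

lemma eval_affineCoords_dehomogenize {p : Projectivization k (Fin (n + 1) → k)}
    (hp : p.rep 0 ≠ 0) (hs : s.IsHomogeneous e) :
    eval (affineCoords p) (dehomogenize s) = (p.rep 0)⁻¹ ^ e * eval p.rep s := by
  have hcomp : (aeval (affineCoords p)).comp dehomogenize =
      (aeval fun a => (p.rep 0)⁻¹ * p.rep a : MvPolynomial (Fin (n + 1)) k →ₐ[k] k) := by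
    ext1 a
    cases a using Fin.cases <;> simp [hp, affineCoords]
  exact (DFunLike.congr_fun hcomp s).trans (aeval_mul_left_of_isHomogeneous hs _ _)

lemma eq_zero_of_dehomogenize_eq_zero (hs : s.IsHomogeneous e) (h : dehomogenize s = 0) :
    s = 0 := by
  have hcomp : (aeval fun a => ratioHom X (X 0) (X a.succ)).comp dehomogenize =
      ratioHom X (X 0 : MvPolynomial (Fin (n + 1)) k) := by
    ext1 a
    cases a using Fin.cases <;> simp [ratioHom_X_self]
  have hzero := DFunLike.congr_fun hcomp s
  rw [AlgHom.comp_apply, h, map_zero] at hzero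
  simpa using (ratioHom_eq_zero_iff X (X_ne_zero 0) hs).mp hzero.symm

end Dehomogenization

section HomogenizeFamily
variable {k σ A : Type*} [Field k] [CommSemiring A] [Algebra k A]

lemma exists_isHomogeneous_forall_map_eq {ι : Type*} [Finite ι] {φ : MvPolynomial σ k →ₐ[k] A}
    {l : MvPolynomial σ k} (hl : l.IsHomogeneous 1) (hφ : φ l = 1) (G : ι → MvPolynomial σ k) :
    ∃ (e : ℕ) (g : ι → MvPolynomial σ k), (∀ a, (g a).IsHomogeneous e) ∧
      ∀ a, φ (g a) = φ (G a) := by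
  have := Fintype.ofFinite ι
  set e := Finset.univ.sup fun a => (G a).totalDegree
  refine ⟨e, fun a => l ^ (e - (G a).totalDegree) * homogenize l (G a), fun a => ?_, fun a => ?_⟩
  · have hle : (G a).totalDegree ≤ e :=
      Finset.le_sup (f := fun a => (G a).totalDegree) (Finset.mem_univ a)
    have h := (hl.pow (e - (G a).totalDegree)).mul (isHomogeneous_homogenize hl (G a))
    rwa [one_mul, Nat.sub_add_cancel hle] at h
  · rw [map_mul, map_pow, hφ, one_pow, one_mul, map_homogenize φ hφ]

end HomogenizeFamily

section RationalPoints
variable {k T : Type*} [Field k] [CommRing T] [Algebra k T]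

lemma sub_algebraMap_mem_ker (ε : T →ₐ[k] k) (x : T) :
    x - algebraMap k T (ε x) ∈ RingHom.ker ε := by
  rw [RingHom.mem_ker, map_sub, AlgHom.commutes, Algebra.algebraMap_self_apply, sub_self]

instance isPrime_ker (ε : T →ₐ[k] k) : (RingHom.ker ε).IsPrime := RingHom.ker_isPrime ε.toRingHom

instance isMaximal_under_ker (A : Subalgebra k T) (ε : T →ₐ[k] k) :
    ((RingHom.ker ε).under A).IsMaximal := by
  refine isMaximal_of_forall_exists_sub_algebraMap_mem (k := k) (Ideal.IsPrime.ne_top inferInstance)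
    fun a => ⟨ε a, ?_⟩
  rw [Ideal.mem_comap, map_sub, ← IsScalarTower.algebraMap_apply]
  exact sub_algebraMap_mem_ker ε (a : T)

instance finite_quotient_ker (A : Subalgebra k T) (ε : T →ₐ[k] k) :
    Module.Finite A (T ⧸ RingHom.ker ε) :=
  .of_surjective (Algebra.linearMap A (T ⧸ RingHom.ker ε)) <|
    Ideal.Quotient.mk_surjective.forall.mpr fun x => ⟨algebraMap k A (ε x),
      (Ideal.Quotient.eq.mpr (sub_algebraMap_mem_ker ε x)).symm⟩

variable [IsDomain T] [Algebra.FiniteType k T] (A : Subalgebra k T)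

lemma isAlgebraic_of_ker_le_map_under {ε : T →ₐ[k] k}
    (hε : RingHom.ker ε ≤ ((RingHom.ker ε).under A).map (algebraMap A T)) :
    Algebra.IsAlgebraic A T := by
  have : Algebra.FiniteType A T := .of_restrictScalars_finiteType k A T
  have := quasiFiniteAt_of_le_map_under _ hε
  exact isAlgebraic_of_quasiFiniteAt (RingHom.ker ε)

lemma exists_ne_zero_forall_exists_smul_eq_algebraMap [Algebra.IsAlgebraic A T] :
    ∃ b : A, b ≠ 0 ∧ ∀ ε : T →ₐ[k] k, ε b ≠ 0 →
      RingHom.ker ε ≤ ((RingHom.ker ε).under A).map (algebraMap A T) →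
        ∀ x : T, ∃ s : A, s ≠ 0 ∧ ∃ a : A, s • x = algebraMap A T a := by
  have : Algebra.FiniteType A T := .of_restrictScalars_finiteType k A T
  obtain ⟨C, b, hC, hb0, hb⟩ := exists_fg_subalgebra_forall_exists_pow_smul_mem A T
  refine ⟨b, hb0, fun ε hεb hε x => ?_⟩
  obtain ⟨s, hs, a, hsa⟩ := exists_notMem_forall_smul_eq_algebraMap (RingHom.ker ε) hC hb hεb
    (fun y => ⟨algebraMap k A (ε y), sub_algebraMap_mem_ker ε y⟩) hε x
  exact ⟨s, ne_of_mem_of_not_mem (zero_mem _) hs |>.symm, a, hsa⟩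

end RationalPoints

section CommonDenominator

lemma exists_ne_zero_forall_smul_eq_algebraMap {A T ι : Type*} [Finite ι] [CommRing A] [IsDomain A]
    [CommRing T] [Algebra A T] {x : ι → T}
    (h : ∀ i, ∃ s : A, s ≠ 0 ∧ ∃ a : A, s • x i = algebraMap A T a) :
    ∃ s : A, s ≠ 0 ∧ ∀ i, ∃ a : A, s • x i = algebraMap A T a := by
  have := Fintype.ofFinite ι
  choose s hs a ha using h
  refine ⟨∏ i, s i, Finset.prod_ne_zero_iff.mpr fun i _ => hs i, fun i => ?_⟩
  obtain ⟨t, ht⟩ := Finset.dvd_prod_of_mem s (Finset.mem_univ i)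
  exact ⟨t * a i, by rw [ht, mul_comm, mul_smul, ha, map_mul, Algebra.smul_def]⟩

end CommonDenominator

section AffineChart
variable {k : Type*} [Field k] {n r d e : ℕ} {f : Fin (r + 1) → MvPolynomial (Fin (n + 1)) k}

/-- The polynomials describing the rational map `φ` on the affine chart `x_0 ≠ 0` of `P^n`. -/
def affineForms (f : Fin (r + 1) → MvPolynomial (Fin (n + 1)) k) (j : Fin (r + 1)) :
    MvPolynomial (Fin n) k :=
  dehomogenize (f j)

lemma bind₁_affineForms (f : Fin (r + 1) → MvPolynomial (Fin (n + 1)) k)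
    (G : MvPolynomial (Fin (r + 1)) k) :
    bind₁ (affineForms f) G = dehomogenize (bind₁ f G) :=
  (DFunLike.congr_fun (comp_aeval f dehomogenize) G).symm

lemma exists_algHom_forall_eq_eval {σ : Type*} {h : MvPolynomial σ k} {u : σ → k}
    (hu : eval u h ≠ 0) : ∃ ε : Localization.Away h →ₐ[k] k,
      ∀ s, ε (algebraMap (MvPolynomial σ k) _ s) = eval u s := by
  have hunit (y : Submonoid.powers h) : IsUnit (aeval u (y : MvPolynomial σ k)) := by
    obtain ⟨_, m, rfl⟩ := y
    exact (map_pow (aeval u) h m ▸ pow_ne_zero m hu).isUnit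
  exact ⟨IsLocalization.liftAlgHom hunit, fun s => IsLocalization.lift_eq hunit s⟩

variable {i : Fin (r + 1)} {ε : Localization.Away (affineForms f i) →ₐ[k] k}
  {q : TargetPoint (formSpace f)}

lemma algebraMap_dehomogenize_mem_map_under (hi : f i ∉ q.space)
    (hq : ∀ w ∈ q.space, ε (algebraMap _ _ (dehomogenize w)) = 0)
    {s : MvPolynomial (Fin (n + 1)) k} (hs : s ∈ morphismFiberIdeal f q) :
    algebraMap _ (Localization.Away (affineForms f i)) (dehomogenize s) ∈
      ((RingHom.ker ε).under (ratioHom (affineForms f) (affineForms f i)).range).map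
        (algebraMap _ _) := by
  obtain ⟨m, hm⟩ := (mem_morphismFiberIdeal_iff (mem_formSpace f i) hi).mp hs
  have hle : q.ideal ≤ Ideal.comap ((algebraMap _ (Localization.Away (affineForms f i))).comp
      (dehomogenize : _ →ₐ[k] MvPolynomial (Fin n) k).toRingHom)
      (((RingHom.ker ε).under (ratioHom (affineForms f) (affineForms f i)).range).map
        (algebraMap _ _)) := Ideal.span_le.mpr fun w hw => by
    have hw0 := hq w hw
    obtain ⟨l, hl, rfl⟩ := exists_bind₁_eq_of_mem_formSpace (q.space_le hw)
    have := algebraMap_bind₁_mem_map_under (f := affineForms f) (h := affineForms f i)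
      (Q := RingHom.ker ε) hl
    rw [bind₁_affineForms] at this
    exact this hw0
  have hfm := hle hm
  have hunit : IsUnit (algebraMap _ (Localization.Away (affineForms f i)) (affineForms f i) ^ m) :=
    (IsLocalization.Away.algebraMap_isUnit _).pow m
  rw [Ideal.mem_comap, map_mul, map_pow] at hfm
  exact (Ideal.unit_mul_mem_iff_mem _ hunit).mp hfm

lemma ker_le_map_under_range_ratioHom (hi : f i ∉ q.space)
    (hq : ∀ w ∈ q.space, ε (algebraMap _ _ (dehomogenize w)) = 0)
    (hX : ∀ a : Fin n, X a.succ - C (ε (algebraMap (MvPolynomial (Fin n) k) _ (X a))) * X 0 ∈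
      morphismFiberIdeal f q) :
    RingHom.ker ε ≤
      ((RingHom.ker ε).under (ratioHom (affineForms f) (affineForms f i)).range).map
        (algebraMap _ _) := by
  set J := ((RingHom.ker ε).under (ratioHom (affineForms f) (affineForms f i)).range).map
    (algebraMap _ (Localization.Away (affineForms f i)))
  have heq : Ideal.Quotient.mkₐ k J = (Algebra.ofId k (_ ⧸ J)).comp ε := by
    refine IsLocalization.algHom_ext (Submonoid.powers (affineForms f i)) ?_
    ext1 a
    have hmem := algebraMap_dehomogenize_mem_map_under hi hq (hX a)
    rw [map_sub, map_mul, dehomogenize_X_succ, dehomogenize_X_zero, mul_one, algHom_C, map_sub,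
      ← IsScalarTower.algebraMap_apply] at hmem
    exact Ideal.Quotient.eq.mpr hmem
  intro x hx
  refine Ideal.Quotient.eq_zero_iff_mem.mp ((DFunLike.congr_fun heq x).trans ?_)
  rw [AlgHom.comp_apply, hx, map_zero]

variable {p : Projectivization k (Fin (n + 1) → k)}

lemma morphismFiberIdeal_imagePoint_eq_pointIdeal (hf : ∀ i, (f i).IsHomogeneous d)
    (hp : IsRegularAt f p) (hlin : IsLinearIdeal (morphismFiberIdeal f (imagePoint f p hp)))
    (hheight : (morphismFiberIdeal f (imagePoint f p hp)).height = n) :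
    morphismFiberIdeal f (imagePoint f p hp) = pointIdeal p.rep := by
  obtain ⟨v, hv, hfib⟩ := exists_eq_pointIdeal hlin hheight
  have : (morphismFiberIdeal f (imagePoint f p hp)).IsPrime := hfib ▸ isPrime_pointIdeal hv
  exact Ideal.eq_of_le_of_height_le _ (morphismFiberIdeal_imagePoint_le hf hp)
    (by rw [hheight, height_pointIdeal p.rep_nonzero])

lemma exists_algHom_eq_eval_and_ker_le_map_under (hf : ∀ i, (f i).IsHomogeneous d)
    (h0 : p.rep 0 ≠ 0) (hi : eval p.rep (f i) ≠ 0) {hp : IsRegularAt f p}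
    (hfib : morphismFiberIdeal f (imagePoint f p hp) = pointIdeal p.rep) :
    ∃ ε : Localization.Away (affineForms f i) →ₐ[k] k,
      (∀ s, ε (algebraMap _ _ s) = eval (affineCoords p) s) ∧
      RingHom.ker ε ≤
        ((RingHom.ker ε).under (ratioHom (affineForms f) (affineForms f i)).range).map
          (algebraMap _ _) := by
  have hinv : (p.rep 0)⁻¹ ≠ 0 := inv_ne_zero h0
  have hFi : eval (affineCoords p) (affineForms f i) ≠ 0 := by
    rw [affineForms, eval_affineCoords_dehomogenize h0 (hf i)]
    exact mul_ne_zero (pow_ne_zero _ hinv) hi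
  obtain ⟨ε, hε⟩ := exists_algHom_forall_eq_eval hFi
  refine ⟨ε, hε, ker_le_map_under_range_ratioHom (notMem_imagePoint_space hi hp)
    (fun w hw => ?_) fun a => ?_⟩
  · obtain ⟨hwf, hw0⟩ := (mem_imagePoint_space hp).mp hw
    rw [hε, eval_affineCoords_dehomogenize h0 (isHomogeneous_of_mem_formSpace hf hwf), hw0,
      mul_zero]
  · rw [hfib, hε, eval_X, ← pointIdeal_smul hinv, affineCoords]
    simpa [h0] using C_mul_X_sub_mem_pointIdeal ((p.rep 0)⁻¹ • p.rep) 0 a.succ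

lemma map_ratioHom_affineForms_ne_zero (hf : ∀ i, (f i).IsHomogeneous d) (h0 : p.rep 0 ≠ 0)
    (hε : ∀ s, ε (algebraMap _ _ s) = eval (affineCoords p) s)
    {G : MvPolynomial (Fin (r + 1)) k} (hG : G.IsHomogeneous e)
    (hpG : eval p.rep (bind₁ f G) ≠ 0) : ε (ratioHom (affineForms f) (affineForms f i) G) ≠ 0 := by
  have hbind : (bind₁ f G).IsHomogeneous (d * e) := hG.aeval f hf
  rw [ratioHom_of_isHomogeneous _ _ hG, map_mul, map_pow, hε, bind₁_affineForms,
    eval_affineCoords_dehomogenize h0 hbind]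
  exact mul_ne_zero (pow_ne_zero _ ((isUnit_invSelf _).map ε).ne_zero)
    (mul_ne_zero (pow_ne_zero _ (inv_ne_zero h0)) hpG)

lemma affineForms_ne_zero (hf : ∀ i, (f i).IsHomogeneous d) (hi : f i ≠ 0) :
    affineForms f i ≠ 0 :=
  mt (eq_zero_of_dehomogenize_eq_zero (hf i)) hi

lemma isBirationalOntoImage_of_ratioHom_affineForms (hf : ∀ i, (f i).IsHomogeneous d)
    (hi : f i ≠ 0) {D : MvPolynomial (Fin (r + 1)) k} {c : Fin n → MvPolynomial (Fin (r + 1)) k}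
    (hD : ratioHom (affineForms f) (affineForms f i) D ≠ 0)
    (hc : ∀ a, ratioHom (affineForms f) (affineForms f i) D *
      algebraMap (MvPolynomial (Fin n) k) _ (X a) =
        ratioHom (affineForms f) (affineForms f i) (c a)) : IsBirationalOntoImage f := by
  obtain ⟨e, g, hg, hgc⟩ := exists_isHomogeneous_forall_map_eq (isHomogeneous_X k i)
    (ratioHom_X_self (affineForms f) i) (Fin.cons D c)
  have hρ (a : Fin (n + 1)) : ratioHom (affineForms f) (affineForms f i) (g 0) *
      algebraMap (MvPolynomial (Fin n) k) _ (dehomogenize (X a)) =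
        ratioHom (affineForms f) (affineForms f i) (g a) := by
    cases a using Fin.cases with
    | zero => rw [dehomogenize_X_zero, map_one, mul_one]
    | succ a => rw [hgc, hgc, Fin.cons_zero, Fin.cons_succ, dehomogenize_X_succ, hc]
  have hbind (a) : (bind₁ f (g a)).IsHomogeneous (d * e) := (hg a).aeval f hf
  have hg0 (a) : bind₁ f (g 0) * X a = bind₁ f (g a) * X 0 := by
    refine sub_eq_zero.mp (eq_zero_of_dehomogenize_eq_zero
      (((hbind 0).mul (isHomogeneous_X k a)).sub ((hbind a).mul (isHomogeneous_X k 0))) ?_)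
    have hρa := hρ a
    rw [ratioHom_of_isHomogeneous _ _ (hg 0), ratioHom_of_isHomogeneous _ _ (hg a), mul_assoc,
      ← map_mul, ((isUnit_invSelf _).pow e).mul_right_inj, bind₁_affineForms,
      bind₁_affineForms] at hρa
    rw [map_sub, map_mul, map_mul, dehomogenize_X_zero, mul_one, sub_eq_zero]
    exact IsLocalization.injective _
      (powers_le_nonZeroDivisors_of_noZeroDivisors (affineForms_ne_zero hf hi)) hρa
  refine isBirationalOntoImage_of_mul_X_eq (i := 0) hf ⟨i, hi⟩ hg (fun a b => ?_) fun h0 => hD ?_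
  · refine mul_left_cancel₀ (X_ne_zero (0 : Fin (n + 1))) ?_
    linear_combination X a * hg0 b - X b * hg0 a
  · rw [← Fin.cons_zero (α := fun _ => _) D c, ← hgc, ratioHom_of_isHomogeneous _ _ (hg 0),
      bind₁_affineForms, h0, map_zero, map_zero, mul_zero]

end AffineChart

section LinearFibres
variable {k : Type*} [Field k] {n r d : ℕ} {f : Fin (r + 1) → MvPolynomial (Fin (n + 1)) k}

lemma forGeneralPoint_exists_algHom_ker_le_map_under (hf : ∀ i, (f i).IsHomogeneous d)
    {i : Fin (r + 1)} (hi : f i ≠ 0)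
    (hfib : ForGeneralPoint fun p : Projectivization k (Fin (n + 1) → k) =>
      ∃ hp : IsRegularAt f p, morphismFiberIdeal f (imagePoint f p hp) = pointIdeal p.rep) :
    ForGeneralPoint fun p : Projectivization k (Fin (n + 1) → k) =>
      ∃ ε : Localization.Away (affineForms f i) →ₐ[k] k,
        (∀ e G, G.IsHomogeneous e → eval p.rep (bind₁ f G) ≠ 0 →
          ε (ratioHom (affineForms f) (affineForms f i) G) ≠ 0) ∧
        RingHom.ker ε ≤
          ((RingHom.ker ε).under (ratioHom (affineForms f) (affineForms f i)).range).map
            (algebraMap _ _) := by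
  refine ((hfib.and (forGeneralPoint_eval_ne_zero hi (hf i))).and
    (forGeneralPoint_eval_ne_zero (X_ne_zero 0) (isHomogeneous_X k 0))).mono ?_
  rintro p ⟨⟨⟨hp, hpfib⟩, hpi⟩, hp0⟩
  rw [eval_X] at hp0
  obtain ⟨ε, hε, hker⟩ := exists_algHom_eq_eval_and_ker_le_map_under hf hp0 hpi hpfib
  exact ⟨ε, fun e G => map_ratioHom_affineForms_ne_zero hf hp0 hε, hker⟩

/- A general fibre is a reduced rational point, so the fraction field of the chart has degree one
over that of the subalgebra `k[f_0 / f_i, …, f_r / f_i]`. -/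
lemma isBirationalOntoImage_of_forGeneralPoint [Infinite k] (hf : ∀ i, (f i).IsHomogeneous d)
    (hne : ∃ i, f i ≠ 0)
    (hfib : ForGeneralPoint fun p : Projectivization k (Fin (n + 1) → k) =>
      ∃ hp : IsRegularAt f p, morphismFiberIdeal f (imagePoint f p hp) = pointIdeal p.rep) :
    IsBirationalOntoImage f := by
  obtain ⟨i, hi⟩ := hne
  have hFi : affineForms f i ≠ 0 := affineForms_ne_zero hf hi
  set ρ := ratioHom (affineForms f) (affineForms f i) with hρ
  have : IsDomain (Localization.Away (affineForms f i)) := IsLocalization.isDomain_localization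
    (powers_le_nonZeroDivisors_of_noZeroDivisors hFi)
  have hgen := forGeneralPoint_exists_algHom_ker_le_map_under hf hi hfib
  have : Algebra.IsAlgebraic ρ.range (Localization.Away (affineForms f i)) :=
    let ⟨_, _, _, hker⟩ := hgen.exists
    isAlgebraic_of_ker_le_map_under _ hker
  obtain ⟨b, hb, hsmul⟩ := exists_ne_zero_forall_exists_smul_eq_algebraMap ρ.range
  obtain ⟨B, rfl⟩ := ρ.rangeRestrict_surjective b
  have hH := isHomogeneous_homogenize (isHomogeneous_X k i) B
  have hHB : ρ (homogenize (X i) B) = ρ B := map_homogenize ρ (ratioHom_X_self _ i) B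
  have hH0 : bind₁ f (homogenize (X i) B) ≠ 0 := fun h0 => hb <| Subtype.ext <| hHB.symm.trans <|
    (ratioHom_eq_zero_iff _ hFi hH).mpr (by rw [bind₁_affineForms, h0, map_zero])
  obtain ⟨p, ⟨ε, hε, hker⟩, hpB⟩ :=
    (hgen.and (forGeneralPoint_eval_ne_zero hH0 (hH.aeval f hf))).exists
  have hεB : ε (ρ.rangeRestrict B : Localization.Away (affineForms f i)) ≠ 0 := by
    have hεH := hε _ _ hH hpB
    rw [← hρ, hHB] at hεH
    exact hεH
  obtain ⟨s, hs, hsX⟩ := exists_ne_zero_forall_smul_eq_algebraMap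
    (x := fun a : Fin n => algebraMap (MvPolynomial (Fin n) k) _ (X a))
    fun a => hsmul ε hεB hker _
  obtain ⟨D, rfl⟩ := ρ.rangeRestrict_surjective s
  choose c hc using fun a => (ρ.rangeRestrict_surjective.exists).mp (hsX a)
  exact isBirationalOntoImage_of_ratioHom_affineForms hf hi (c := c)
    (fun h => hs (Subtype.ext h)) hc

end LinearFibres

end RowIdeals

end

theorem mainTheorem2_general {k : Type*} [Field k] [Infinite k] {n r d : ℕ}
    (f : Fin (r + 1) → MvPolynomial (Fin (n + 1)) k)
    (hf : ∀ i, (f i).IsHomogeneous d)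
    (hne : ∃ i, f i ≠ 0) :
    (∀ q : RowIdeals.TargetPoint (RowIdeals.formSpace f),
      RowIdeals.morphismFiberIdeal f q ≠ ⊤ →
        1 + ((RowIdeals.morphismFiberIdeal f q).height : WithBot ℕ∞) ≤
          RowIdeals.analyticSpread f) ∧
    (RowIdeals.ForGeneralPoint fun p : Projectivization k (Fin (n + 1) → k) =>
      ∃ hp : RowIdeals.IsRegularAt f p,
        RowIdeals.analyticSpread f =
          1 + ((RowIdeals.morphismFiberIdeal f (RowIdeals.imagePoint f p hp)).height :
            WithBot ℕ∞)) ∧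
    ((∃ q : RowIdeals.TargetPoint (RowIdeals.formSpace f),
        RowIdeals.IsLinearIdeal (RowIdeals.rowIdeal f q) ∧
        (RowIdeals.rowIdeal f q).height = (n : ℕ∞) ∧
        ¬ RowIdeals.formIdeal f ≤ RowIdeals.rowIdeal f q) →
      RowIdeals.IsBirationalOntoImage f) ∧
    (RowIdeals.IsBirationalOntoImage f ↔
      RowIdeals.ForGeneralPoint fun p : Projectivization k (Fin (n + 1) → k) =>
        ∃ hp : RowIdeals.IsRegularAt f p,
          RowIdeals.IsLinearIdeal
            (RowIdeals.morphismFiberIdeal f (RowIdeals.imagePoint f p hp)) ∧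
          (RowIdeals.morphismFiberIdeal f (RowIdeals.imagePoint f p hp)).height =
            (n : ℕ∞)) := by
  refine ⟨fun q hq => add_le_add le_rfl (RowIdeals.height_morphismFiberIdeal_le hq), ?_, ?_,
    fun hbir => ?_, fun hgen => ?_⟩
  · exact (RowIdeals.forGeneralPoint_topologicalKrullDim_eq hf hne).mono fun p ⟨hp, h⟩ =>
      ⟨hp, by rw [RowIdeals.analyticSpread, h]⟩
  · rintro ⟨q, hlin, hheight, hle⟩
    exact RowIdeals.isBirationalOntoImage_of_rowIdeal hf hlin hheight hle
  · exact (hbir.forGeneralPoint hf hne).mono fun p ⟨hp, h⟩ =>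
      ⟨hp, h ▸ RowIdeals.isLinearIdeal_pointIdeal _, h ▸ RowIdeals.height_pointIdeal p.rep_nonzero⟩
  · exact RowIdeals.isBirationalOntoImage_of_forGeneralPoint hf hne <| hgen.mono
      fun p ⟨hp, hlin, hheight⟩ =>
        ⟨hp, RowIdeals.morphismFiberIdeal_imagePoint_eq_pointIdeal hf hp hlin hheight⟩

theorem mainTheorem2 {k : Type*} [Field k] [Infinite k] {n r d : ℕ}
    (f : Fin (r + 1) → MvPolynomial (Fin (n + 1)) k)
    (hf : ∀ i, (f i).IsHomogeneous d)
    (hli : LinearIndependent k f)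
    (hcodim : 2 ≤ (RowIdeals.formIdeal f).height) :
    (∀ q : RowIdeals.TargetPoint (RowIdeals.formSpace f),
      RowIdeals.morphismFiberIdeal f q ≠ ⊤ →
        1 + ((RowIdeals.morphismFiberIdeal f q).height : WithBot ℕ∞) ≤
          RowIdeals.analyticSpread f) ∧
    (RowIdeals.ForGeneralPoint fun p : Projectivization k (Fin (n + 1) → k) =>
      ∃ hp : RowIdeals.IsRegularAt f p,
        RowIdeals.analyticSpread f =
          1 + ((RowIdeals.morphismFiberIdeal f (RowIdeals.imagePoint f p hp)).height :
            WithBot ℕ∞)) ∧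
    ((∃ q : RowIdeals.TargetPoint (RowIdeals.formSpace f),
        RowIdeals.IsLinearIdeal (RowIdeals.rowIdeal f q) ∧
        (RowIdeals.rowIdeal f q).height = (n : ℕ∞) ∧
        ¬ RowIdeals.formIdeal f ≤ RowIdeals.rowIdeal f q) →
      RowIdeals.IsBirationalOntoImage f) ∧
    (RowIdeals.IsBirationalOntoImage f ↔
      RowIdeals.ForGeneralPoint fun p : Projectivization k (Fin (n + 1) → k) =>
        ∃ hp : RowIdeals.IsRegularAt f p,
          RowIdeals.IsLinearIdeal
            (RowIdeals.morphismFiberIdeal f (RowIdeals.imagePoint f p hp)) ∧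
          (RowIdeals.morphismFiberIdeal f (RowIdeals.imagePoint f p hp)).height =
            (n : ℕ∞)) := by
  exact mainTheorem2_general f hf ⟨0, hli.ne_zero 0⟩
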